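/- Let $K\ge 1$ users share a TDMA fading channel. The joint fading state $\mathbf h=(h_1,\dots,h_K)$ (the vector of channel power gains) is a random vector with non-negative components whose law has a density with respect to Lebesgue measure, and $E[\log(1+h_k)]<\infty$ for every $k$. Fix power weights $\mu_k>0$ and rate targets $\bar R_k>0$; put $\bar{\mathbf r}=(\bar R_1,\dots,\bar R_K)$. A policy is a pair of measurable functions $(\mathbf r(\cdot),\boldsymbol\tau(\cdot))$ of $\mathbf h$ with $r_k(\mathbf h)\ge 0$, $\tau_k(\mathbf h)\ge 0$ and $\sum_k\tau_k(\mathbf h)=1$. Let $\tilde{\mathcal P}(\bar{\mathbf r})$ be the set of all $\bar{\mathbf p}=(\bar P_1,\dots,\bar P_K)\ge\mathbf 0$ for which some policy satisfies $E[\tau_k(\mathbf h)r_k(\mathbf h)]\ge\bar R_k$ and $E\big[\tfrac{\tau_k(\mathbf h)}{h_k}(2^{r_k(\mathbf h)}-1)\big]\le\bar P_k$ for all $k$. An optimal power vector is a minimizer of $\sum_k\mu_k\bar P_k$ over $\tilde{\mathcal P}(\bar{\mathbf r})$. For $\boldsymbol\lambda\in(0,\infty)^K$ let $$r_{k,\min}(\mathbf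 h)=\Big[\log_2\lambda_k-\log_2\frac{\mu_k\ln 2}{h_k}\Big]_+,\qquad \varphi_k(\mathbf h)=\frac{\mu_k}{h_k}\big(2^{r_{k,\min}(\mathbf h)}-1\big)-\lambda_k r_{k,\min}(\mathbf h).$$ The greedy allocation with multiplier $\boldsymbol\lambda$ gives, in each state $\mathbf h$, all the time to the users with the smallest $\varphi_k(\mathbf h)$ (divided arbitrarily, in a measurable way, if there are several), and a user that is given time transmits at rate $r_{k,\min}(\mathbf h)$. Let $\bar R_k(\boldsymbol\lambda)=E[\tau_k(\mathbf h)r_{k,\min}(\mathbf h)]$ and $\bar P_k(\boldsymbol\lambda)=E\big[\tfrac{\tau_k(\mathbf h)}{h_k}(2^{r_{k,\min}(\mathbf h)}-1)\big]$ be the average rates and powers of this allocation, and $\bar{\mathbf r}(\boldsymbol\lambda)$, $\bar{\mathbf p}(\boldsymbol\lambda)$ the vectors that they form. Then there are a unique optimal power vector $\bar{\mathbf p}^*$ and a unique $\boldsymbol\lambda^*\in(0,\infty)^K$ with $\bar{\mathbf r}(\boldsymbol\lambda^*)=\bar{\mathbf r}$; $\boldsymbol\lambda^*$ does not depend on how ties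 are divided, and $\bar{\mathbf p}(\boldsymbol\lambda^*)=\bar{\mathbf p}^*$. For all $\boldsymbol\lambda\in(0,\infty)^K$ and $k$ there is exactly one $x>0$ such that user $k$ has average rate $\bar R_k$ when $\lambda_k$ is replaced by $x$ and the other components of $\boldsymbol\lambda$ are kept. Starting from an arbitrary $\boldsymbol\lambda(0)\in(0,\infty)^K$, define $\boldsymbol\lambda(l+1)$ by letting $\lambda_k(l+1)$ be this $x$ for $\boldsymbol\lambda=\boldsymbol\lambda(l)$, simultaneously for all $k$. Then, as $l\to\infty$, $$\boldsymbol\lambda(l)\to\boldsymbol\lambda^*,\qquad \bar{\mathbf p}(\boldsymbol\lambda(l))\to\bar{\mathbf p}^*,\qquad \bar{\mathbf r}(\boldsymbol\lambda(l))\to\bar{\mathbf r}.$$ -/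

import Mathlib

open MeasureTheory

namespace TDMA

noncomputable section

/-- `log₂`-water-filling rate
`r_{k,min}(h) = [log₂ λ_k - log₂ (ln 2 · μ_k / h_k)]₊` of a user with multiplier `lam`,
power weight `mu` and channel gain `x`. -/
def waterfillRate (mu lam x : ℝ) : ℝ :=
  max (Real.logb 2 lam - Real.logb 2 (Real.log 2 * mu / x)) 0

/-- The cost `f_k(r) = (μ_k / h_k) (2 ^ r - 1) - λ_k r`. -/
def lagrangeCost (mu lam x r : ℝ) : ℝ :=
  mu / x * ((2 : ℝ) ^ r - 1) - lam * r

/-- The channel quality indicator `f_k(r_{k,min}(h))` (the smaller the better). -/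
def quality (mu lam x : ℝ) : ℝ :=
  lagrangeCost mu lam x (waterfillRate mu lam x)


/-- Rate and time allocation policies: measurable functions of the fading state `h`, with
non-negative rates and with non-negative time fractions that add up to one in every state. -/
structure IsPolicy {K : ℕ} (tau r : (Fin K → ℝ) → Fin K → ℝ) : Prop where
  measurable_tau : Measurable tau
  measurable_r : Measurable r
  tau_nonneg : ∀ h k, 0 ≤ tau h k
  tau_sum : ∀ h, ∑ k, tau h k = 1
  r_nonneg : ∀ h k, 0 ≤ r h k

/-- The policies that meet the individual average rate constraints
`E[τ_k(h) r_k(h)] ≥ R_k`; the expectation of a non-negative quantity is taken in `[0, ∞]`. -/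
def MeetsRates {K : ℕ} (nu : Measure (Fin K → ℝ)) (R : Fin K → ℝ)
    (tau r : (Fin K → ℝ) → Fin K → ℝ) : Prop :=
  IsPolicy tau r ∧
    ∀ k, ENNReal.ofReal (R k) ≤ ∫⁻ h, ENNReal.ofReal (tau h k * r h k) ∂nu

/-- The power vectors supported by a policy:
`P_k ≥ E[(τ_k(h) / h_k) (2 ^ r_k(h) - 1)]` for all `k`, the expectation taken in `[0, ∞]`. -/
def supportedPowers {K : ℕ} (nu : Measure (Fin K → ℝ)) (tau r : (Fin K → ℝ) → Fin K → ℝ) :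
    Set (Fin K → ℝ) :=
  {p | ∀ k, 0 ≤ p k ∧
    ∫⁻ h, ENNReal.ofReal (tau h k / h k * ((2 : ℝ) ^ r h k - 1)) ∂nu ≤ ENNReal.ofReal (p k)}

/-- The power region under individual average rate constraints. -/
def powerRegion {K : ℕ} (nu : Measure (Fin K → ℝ)) (R : Fin K → ℝ) : Set (Fin K → ℝ) :=
  {p | ∃ tau r : (Fin K → ℝ) → Fin K → ℝ, MeetsRates nu R tau r ∧ p ∈ supportedPowers nu tau r}

/-- `p` minimizes the weighted power `∑ μ_k P_k` over the power region. -/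
def IsOptimalPower {K : ℕ} (nu : Measure (Fin K → ℝ)) (mu R p : Fin K → ℝ) : Prop :=
  p ∈ powerRegion nu R ∧ ∀ q ∈ powerRegion nu R, ∑ k, mu k * p k ≤ ∑ k, mu k * q k

/-- A greedy time allocation rule assigns to every positive multiplier vector `lam` and every
fading state `h` time fractions that are supported on the users with the smallest quality
indicator; the division among several such users is arbitrary. -/
structure IsGreedyRule {K : ℕ} (mu : Fin K → ℝ)
    (tau : (Fin K → ℝ) → (Fin K → ℝ) → Fin K → ℝ) : Prop where
  measurable_tau : ∀ lam, (∀ k, 0 < lam k) → Measurable (tau lam)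
  tau_nonneg : ∀ lam, (∀ k, 0 < lam k) → ∀ h k, 0 ≤ tau lam h k
  tau_sum : ∀ lam, (∀ k, 0 < lam k) → ∀ h, ∑ k, tau lam h k = 1
  tau_support : ∀ lam, (∀ k, 0 < lam k) → ∀ h k, tau lam h k ≠ 0 →
    ∀ j, quality (mu k) (lam k) (h k) ≤ quality (mu j) (lam j) (h j)

/-- Greedy rules exist: share the time equally among the best users. -/
theorem exists_isGreedyRule {K : ℕ} (hK : 0 < K) (mu : Fin K → ℝ) :
    ∃ tau, IsGreedyRule mu tau := by
  classical
  let q : (Fin K → ℝ) → (Fin K → ℝ) → Fin K → ℝ := fun lam h k => quality (mu k) (lam k) (h k)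
  let s : (Fin K → ℝ) → (Fin K → ℝ) → Fin K → ℝ := fun lam h k => if ∀ j, q lam h k ≤ q lam h j then 1 else 0
  have hq : ∀ lam k, Measurable (fun h => q lam h k) := by
    intro lam k
    simp only [q, quality, lagrangeCost, waterfillRate, Real.logb]
    fun_prop
  have hs : ∀ lam k, Measurable (fun h => s lam h k) := by
    intro lam k
    refine Measurable.ite ?_ measurable_const measurable_const
    simp only [Set.ofPred_forall]
    exact MeasurableSet.iInter fun j => measurableSet_le (hq _ _) (hq _ _)
  have h0 : ∀ lam h k, 0 ≤ s lam h k := by intro lam h k; simp only [s]; split_ifs <;> norm_num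
  refine ⟨fun lam h k => s lam h k / ∑ j, s lam h j, ⟨?_, ?_, ?_, ?_⟩⟩
  · intro lam _
    refine measurable_pi_lambda _ fun k => (hs lam k).div (Finset.measurable_sum _ fun j _ => hs lam j)
  · intro lam _ h k; exact div_nonneg (h0 _ _ _) (Finset.sum_nonneg fun j _ => h0 _ _ _)
  · intro lam _ h
    rw [← Finset.sum_div]
    apply div_self
    have : Nonempty (Fin K) := ⟨⟨0, hK⟩⟩
    obtain ⟨i, hi⟩ := Finite.exists_min (q lam h)
    have : s lam h i = 1 := by simp [s, hi]
    have := Finset.single_le_sum (f := s lam h) (fun j _ => h0 lam h j) (Finset.mem_univ i)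
    linarith
  · intro lam _ h k hk
    by_contra hc
    exact hk (by have : s lam h k = 0 := if_neg hc
                 simp [this])

/-- The average rate of user `k` under the greedy allocation with multiplier `lam`. -/
def avgRate {K : ℕ} (nu : Measure (Fin K → ℝ)) (mu : Fin K → ℝ)
    (tau : (Fin K → ℝ) → (Fin K → ℝ) → Fin K → ℝ) (lam : Fin K → ℝ) (k : Fin K) : ℝ :=
  ∫ h, tau lam h k * waterfillRate (mu k) (lam k) (h k) ∂nu

/-- The average power of user `k` under the greedy allocation with multiplier `lam`. -/
def avgPower {K : ℕ} (nu : Measure (Fin K → ℝ)) (mu : Fin K → ℝ)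
    (tau : (Fin K → ℝ) → (Fin K → ℝ) → Fin K → ℝ) (lam : Fin K → ℝ) (k : Fin K) : ℝ :=
  ∫ h, tau lam h k / h k * ((2 : ℝ) ^ waterfillRate (mu k) (lam k) (h k) - 1) ∂nu

/-- `x` is a positive multiplier of user `k` for which user `k` has average rate `R k`, when
the multipliers of the other users are fixed at those of `lam`. -/
def IsUpdate {K : ℕ} (nu : Measure (Fin K → ℝ)) (mu R : Fin K → ℝ)
    (tau : (Fin K → ℝ) → (Fin K → ℝ) → Fin K → ℝ) (lam : Fin K → ℝ) (k : Fin K) (x : ℝ) : Prop :=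
  0 < x ∧ avgRate nu mu tau (Function.update lam k x) k = R k

/-- `seq` is a run of the iterative algorithm: it starts at a positive vector, and every step
updates all the components simultaneously from the previous iterate. -/
def IsRun {K : ℕ} (nu : Measure (Fin K → ℝ)) (mu R : Fin K → ℝ)
    (tau : (Fin K → ℝ) → (Fin K → ℝ) → Fin K → ℝ) (seq : ℕ → Fin K → ℝ) : Prop :=
  (∀ k, 0 < seq 0 k) ∧ ∀ l k, IsUpdate nu mu R tau (seq l) k (seq (l + 1) k)

end

end TDMA

/-! Two facts carry the proof: the multiplier-to-rate map is monotone in a competitive sense, and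
the greedy allocation minimizes a Lagrangian state by state.

Where a user's quality is negative, it strictly decreases in the gain (`quality_lt_of_gain_lt`).
Since the law has a density, ties between users with positive rate are therefore null, and all
averages may be computed from sole best users only (`soleRate`, `solePower`). These depend
continuously on the multipliers, by dominated convergence.

A user's rate increases with its own multiplier and decreases with the others'. Hence the
simultaneous update preserves order (`le_of_update`): it increases from a subsolution and decreases
from a supersolution, and every run is squeezed between two such runs. Increasing runs stay bounded
because a large multiplier forces a large total rate (`exists_lt_sum_soleRate`). Limits of runs
solve the rate equation, so uniqueness of the solution gives convergence (`exists_solution`).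

Uniqueness comes from `duality`. Any policy meeting the rates at equal cost must use the same
water-filling rates whenever it transmits, and a positive rate determines the multiplier. The same
theorem identifies the optimal powers. -/

namespace TDMA

/-! ### Monotone iteration for abstract rate maps -/

/-- The properties of the map from multipliers to average rates that the iteration relies on. -/
structure IsRateMap {ι : Type*} [Fintype ι] [DecidableEq ι] (ρ : (ι → ℝ) → ι → ℝ) : Prop where
  continuousAt : ∀ l, (∀ k, 0 < l k) → ContinuousAt ρ l
  anti : ∀ l l' : ι → ℝ, (∀ k, 0 < l k) → l ≤ l' → ∀ k, l k = l' k → ρ l' k ≤ ρ l k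
  mono : ∀ l, (∀ k, 0 < l k) → ∀ k x y, 0 < x → x ≤ y →
    ρ (Function.update l k x) k ≤ ρ (Function.update l k y) k
  strictMono : ∀ l, (∀ k, 0 < l k) → ∀ k x y, 0 < x → x < y →
    0 < ρ (Function.update l k x) k →
      ρ (Function.update l k x) k < ρ (Function.update l k y) k
  small : ∀ k, ∀ ε > 0, ∃ δ > 0, ∀ l : ι → ℝ, (∀ j, 0 < l j) → l k ≤ δ → ρ l k < ε
  large : ∀ C : ℝ, ∃ B : ℝ, ∀ l : ι → ℝ, (∀ j, 0 < l j) → ∀ k, B < l k → C < ∑ j, ρ l j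
  injective : ∀ l l', (∀ k, 0 < l k) → (∀ k, 0 < l' k) → (∀ k, 0 < ρ l k) → ρ l = ρ l' → l = l'

/-- A run of the simultaneous update iteration for a general rate map. -/
structure IsRateRun {ι : Type*} [DecidableEq ι] (ρ : (ι → ℝ) → ι → ℝ) (R : ι → ℝ)
    (s : ℕ → ι → ℝ) : Prop where
  pos : ∀ n k, 0 < s n k
  step : ∀ n k, ρ (Function.update (s n) k (s (n + 1) k)) k = R k

lemma update_pos {ι : Type*} [DecidableEq ι] {l : ι → ℝ} (hl : ∀ k, 0 < l k) (k : ι) {x : ℝ}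
    (hx : 0 < x) : ∀ j, 0 < Function.update l k x j := by
  intro j
  rcases eq_or_ne j k with rfl | h
  · simpa using hx
  · simpa [h] using hl j

namespace IsRateMap

variable {ι : Type*} [Fintype ι] [DecidableEq ι] {ρ : (ι → ℝ) → ι → ℝ}

/-- Comparison principle: stronger competitors lower user `k`'s rate, so at least as large a
multiplier is needed for the same rate. Positivity of `r` makes strict monotonicity applicable. The
inequality form serves sub- and supersolutions alike. -/
lemma le_of_update (H : IsRateMap ρ) {l l' : ι → ℝ} (hl : ∀ k, 0 < l k) (hll : l ≤ l')
    {k : ι} {x y r : ℝ} (hy : 0 < y) (hr : 0 < r)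
    (h1 : ρ (Function.update l k x) k ≤ r) (h2 : r ≤ ρ (Function.update l' k y) k) : x ≤ y := by
  by_contra! hxy
  have h3 : ρ (Function.update l' k y) k ≤ ρ (Function.update l k y) k :=
    H.anti _ _ (update_pos hl k hy) (update_le_update_iff.2 ⟨le_rfl, fun j _ => hll j⟩) k
      (by simp)
  have := H.strictMono l hl k y x hy hxy (by linarith)
  linarith

/-- The total rate becomes large while raising component `k` cannot raise the other rates, so the
growth must fall to user `k`. -/
lemma exists_lt_update (H : IsRateMap ρ) {l : ι → ℝ} (hl : ∀ k, 0 < l k) (k : ι) (C : ℝ) :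
    ∃ x, 0 < x ∧ C < ρ (Function.update l k x) k := by
  obtain ⟨B, hB⟩ := H.large (C + ∑ j ∈ Finset.univ.erase k, ρ l j)
  have hx : 0 < max (B + 1) (l k) := lt_max_of_lt_right (hl k)
  refine ⟨max (B + 1) (l k), hx, ?_⟩
  have h1 := hB _ (update_pos hl k hx) k (by simp)
  rw [← Finset.add_sum_erase _ _ (Finset.mem_univ k)] at h1
  have h2 : ∑ j ∈ Finset.univ.erase k, ρ (Function.update l k (max (B + 1) (l k))) j
      ≤ ∑ j ∈ Finset.univ.erase k, ρ l j := by
    refine Finset.sum_le_sum fun j hj => H.anti _ _ hl ?_ j ?_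
    · exact le_update_iff.2 ⟨le_max_right _ _, fun _ _ => le_rfl⟩
    · simp [Finset.ne_of_mem_erase hj]
  linarith

lemma existsUnique_update (H : IsRateMap ρ) {R : ι → ℝ} (hR : ∀ k, 0 < R k) {l : ι → ℝ}
    (hl : ∀ k, 0 < l k) (k : ι) : ∃! x : ℝ, 0 < x ∧ ρ (Function.update l k x) k = R k := by
  obtain ⟨δ, hδ, hs⟩ := H.small k (R k) (hR k)
  obtain ⟨X, hX, hb⟩ := H.exists_lt_update hl k (R k)
  have ha := hs (Function.update l k δ) (update_pos hl k hδ) (by simp)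
  have hδX : δ ≤ X := by
    by_contra! h
    have := H.mono l hl k X δ hX h.le
    linarith
  have hc : ContinuousOn (fun x => ρ (Function.update l k x) k) (Set.Icc δ X) := by
    intro x hx
    apply ContinuousAt.continuousWithinAt
    have h1 := H.continuousAt _ (update_pos hl k (hδ.trans_le hx.1))
    have h2 : ContinuousAt (fun x => Function.update l k x) x :=
      (continuous_const.update k continuous_id).continuousAt
    exact (continuous_apply k).continuousAt.comp
      (ContinuousAt.comp (f := fun x => Function.update l k x) h1 h2)
  obtain ⟨x, hx, hxe⟩ := intermediate_value_Icc hδX hc ⟨ha.le, hb.le⟩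
  refine ⟨x, ⟨hδ.trans_le hx.1, hxe⟩, fun y hy => le_antisymm ?_ ?_⟩
  · exact H.le_of_update hl le_rfl (hδ.trans_le hx.1) (hR k) hy.2.le (ge_of_eq hxe)
  · exact H.le_of_update hl le_rfl hy.1 (hR k) (le_of_eq hxe) hy.2.ge

lemma exists_run (H : IsRateMap ρ) {R : ι → ℝ} (hR : ∀ k, 0 < R k) {l : ι → ℝ}
    (hl : ∀ k, 0 < l k) : ∃ s, IsRateRun ρ R s ∧ s 0 = l := by
  have h : ∀ a : {l : ι → ℝ // ∀ k, 0 < l k}, ∃ b : {l : ι → ℝ // ∀ k, 0 < l k},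
      ∀ k, ρ (Function.update a.1 k (b.1 k)) k = R k := by
    intro a
    choose b hb _ using fun k => H.existsUnique_update hR a.2 k
    exact ⟨⟨b, fun k => (hb k).1⟩, fun k => (hb k).2⟩
  choose T hT using h
  refine ⟨fun n => (T^[n] ⟨l, hl⟩).1, ⟨fun n => (T^[n] ⟨l, hl⟩).2, fun n k => ?_⟩, rfl⟩
  simp only [Function.iterate_succ_apply']
  exact hT _ k

lemma run_le_run (H : IsRateMap ρ) {R : ι → ℝ} (hR : ∀ k, 0 < R k) {s t : ℕ → ι → ℝ}
    (hs : IsRateRun ρ R s) (ht : IsRateRun ρ R t) (h0 : s 0 ≤ t 0) (n : ℕ) : s n ≤ t n := by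
  induction n with
  | zero => exact h0
  | succ n ih =>
    exact fun k => H.le_of_update (hs.pos n) ih (ht.pos _ k) (hR k) (hs.step n k).le (ht.step n k).ge

/-- The shifted sequence is again a run, so order preservation propagates the first step, which goes
up from a subsolution. -/
lemma run_monotone (H : IsRateMap ρ) {R : ι → ℝ} (hR : ∀ k, 0 < R k) {s : ℕ → ι → ℝ}
    (hs : IsRateRun ρ R s) (h0 : ρ (s 0) ≤ R) : Monotone s := by
  refine monotone_nat_of_le_succ fun n => H.run_le_run hR hs (t := fun n => s (n + 1))
    ⟨fun n => hs.pos _, fun n => hs.step _⟩ ?_ n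
  intro k
  refine H.le_of_update (hs.pos 0) le_rfl (hs.pos 1 k) (hR k) ?_ (hs.step 0 k).ge
  simpa using h0 k

lemma run_antitone (H : IsRateMap ρ) {R : ι → ℝ} (hR : ∀ k, 0 < R k) {s : ℕ → ι → ℝ}
    (hs : IsRateRun ρ R s) (h0 : R ≤ ρ (s 0)) : Antitone s := by
  refine antitone_nat_of_succ_le fun n => H.run_le_run hR (s := fun n => s (n + 1))
    ⟨fun n => hs.pos _, fun n => hs.step _⟩ hs ?_ n
  intro k
  refine H.le_of_update (hs.pos 0) le_rfl (hs.pos 0 k) (hR k) (hs.step 0 k).le ?_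
  simpa using h0 k

lemma eq_of_run_tendsto (H : IsRateMap ρ) {R : ι → ℝ} {s : ℕ → ι → ℝ}
    (hs : IsRateRun ρ R s) {a : ι → ℝ} (ha : ∀ k, 0 < a k)
    (h : Filter.Tendsto s Filter.atTop (nhds a)) : ρ a = R := by
  funext k
  have h1 : Filter.Tendsto (fun n => Function.update (s n) k (s (n + 1) k)) Filter.atTop
      (nhds (Function.update a k (a k))) :=
    h.update k (((continuous_apply k).tendsto a).comp (h.comp (Filter.tendsto_add_atTop_nat 1)))
  rw [Function.update_eq_self] at h1
  have h2 := ((continuous_apply k).tendsto (ρ a)).comp ((H.continuousAt a ha).tendsto.comp h1)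
  refine tendsto_nhds_unique h2 ?_
  refine tendsto_const_nhds.congr fun n => ?_
  exact (hs.step n k).symm

lemma run_tendsto_of_le (H : IsRateMap ρ) {R : ι → ℝ} (hR : ∀ k, 0 < R k) {s : ℕ → ι → ℝ}
    (hs : IsRateRun ρ R s) (h0 : ρ (s 0) ≤ R) :
    ∃ a, s 0 ≤ a ∧ ρ a = R ∧ Filter.Tendsto s Filter.atTop (nhds a) := by
  have hm := H.run_monotone hR hs h0
  -- Iterates remain subsolutions: raising component `k` alone to its next value would bring the
  -- rate exactly to `R k`.
  have hsub : ∀ n k, ρ (s n) k ≤ R k := by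
    intro n k
    have := H.mono (s n) (hs.pos n) k _ _ (hs.pos n k) (hm n.le_succ k)
    rwa [Function.update_eq_self, hs.step] at this
  obtain ⟨B, hB⟩ := H.large (∑ k, R k)
  have hbdd : BddAbove (Set.range s) := by
    refine ⟨fun _ => B, ?_⟩
    rintro _ ⟨n, rfl⟩ k
    by_contra! h
    have := hB _ (hs.pos n) k h
    have := Finset.sum_le_sum fun k (_ : k ∈ Finset.univ) => hsub n k
    linarith
  have ht := tendsto_atTop_ciSup hm hbdd
  have hle := le_ciSup hbdd 0
  exact ⟨_, hle, H.eq_of_run_tendsto hs (fun k => (hs.pos 0 k).trans_le (hle k)) ht, ht⟩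

/-- Used for the target itself, and with a raised target to build a supersolution above a given
point. -/
lemma exists_le_eq (H : IsRateMap ρ) {R : ι → ℝ} (hR : ∀ k, 0 < R k) {l : ι → ℝ}
    (hl : ∀ k, 0 < l k) (h : ρ l ≤ R) : ∃ a, l ≤ a ∧ ρ a = R := by
  obtain ⟨s, hs, rfl⟩ := H.exists_run hR hl
  obtain ⟨a, h1, h2, -⟩ := H.run_tendsto_of_le hR hs h
  exact ⟨a, h1, h2⟩

lemma exists_le_subsolution (H : IsRateMap ρ) {R : ι → ℝ} (hR : ∀ k, 0 < R k) {l : ι → ℝ}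
    (hl : ∀ k, 0 < l k) : ∃ a, (∀ k, 0 < a k) ∧ a ≤ l ∧ ρ a ≤ R := by
  choose δ hδ h using fun k => H.small k (R k) (hR k)
  have hp : ∀ k, 0 < min (δ k) (l k) := fun k => lt_min (hδ k) (hl k)
  exact ⟨fun k => min (δ k) (l k), hp, fun k => min_le_right _ _,
    fun k => (h k _ hp (min_le_left _ _)).le⟩

/-- The equation `ρ a = R` has a unique positive solution, to which every run converges. -/
theorem exists_solution (H : IsRateMap ρ) {R : ι → ℝ} (hR : ∀ k, 0 < R k) :
    ∃ a, (∀ k, 0 < a k) ∧ ρ a = R ∧ (∀ l, (∀ k, 0 < l k) → ρ l = R → l = a) ∧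
      ∀ s, IsRateRun ρ R s → Filter.Tendsto s Filter.atTop (nhds a) := by
  obtain ⟨m, hm, -, hmR⟩ := H.exists_le_subsolution hR (l := fun _ => 1) (fun _ => one_pos)
  obtain ⟨a, hma, haR⟩ := H.exists_le_eq hR hm hmR
  have ha : ∀ k, 0 < a k := fun k => (hm k).trans_le (hma k)
  have huniq : ∀ l, (∀ k, 0 < l k) → ρ l = R → l = a := fun l hl h =>
    H.injective l a hl ha (fun k => by rw [h]; exact hR k) (h.trans haR.symm)
  refine ⟨a, ha, haR, huniq, fun s hs => ?_⟩
  obtain ⟨m, hm, hms, hmR⟩ := H.exists_le_subsolution hR (hs.pos 0)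
  -- Raising the target to `R ⊔ ρ (s 0)` makes `s 0` a subsolution; the solution `M` above it is a
  -- supersolution for `R`.
  obtain ⟨M, hsM, hM⟩ := H.exists_le_eq (R := R ⊔ ρ (s 0))
    (fun k => lt_sup_of_lt_left (hR k)) (hs.pos 0) le_sup_right
  have hMpos : ∀ k, 0 < M k := fun k => (hs.pos 0 k).trans_le (hsM k)
  obtain ⟨u, hu, rfl⟩ := H.exists_run hR hm
  obtain ⟨v, hv, rfl⟩ := H.exists_run hR hMpos
  obtain ⟨b, hb, hbR, hub⟩ := H.run_tendsto_of_le hR hu hmR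
  obtain rfl := huniq b (fun k => (hm k).trans_le (hb k)) hbR
  have hus := H.run_le_run hR hu hs hms
  have hsv := H.run_le_run hR hs hv hsM
  have hva : Filter.Tendsto v Filter.atTop (nhds b) := by
    have hanti := H.run_antitone hR hv (by rw [hM]; exact le_sup_left)
    -- The lower run keeps the limit of the decreasing run strictly positive, where continuity and
    -- uniqueness apply.
    have hlow : u 0 ∈ lowerBounds (Set.range v) := by
      rintro _ ⟨n, rfl⟩
      exact (H.run_monotone hR hu hmR n.zero_le).trans ((hus n).trans (hsv n))
    have ht := tendsto_atTop_ciInf hanti ⟨_, hlow⟩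
    have hp : ∀ k, 0 < (⨅ n, v n) k := fun k =>
      (hm k).trans_le (le_ciInf (fun n => hlow ⟨n, rfl⟩) k)
    rwa [huniq _ hp (H.eq_of_run_tendsto hv hp ht)] at ht
  rw [tendsto_pi_nhds] at hub hva ⊢
  exact fun k => tendsto_of_tendsto_of_tendsto_of_le_of_le (hub k) (hva k)
    (fun n => hus n k) (fun n => hsv n k)

end IsRateMap

end TDMA

/-! ### Water-filling for a single user -/

namespace TDMA

lemma waterfillRate_nonneg (m l x : ℝ) : 0 ≤ waterfillRate m l x := le_max_right _ _

lemma waterfillRate_eq {m l x : ℝ} (hm : 0 < m) (hl : 0 < l) (hx : 0 < x) :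
    waterfillRate m l x = max (Real.logb 2 (l * x / (Real.log 2 * m))) 0 := by
  have h2 : 0 < Real.log 2 := Real.log_pos one_lt_two
  rw [waterfillRate, ← Real.logb_div hl.ne' (by positivity), div_div_eq_mul_div]

/-- First-order optimality of the water-filling rate. -/
lemma waterfillRate_optimal {m l x : ℝ} (hm : 0 < m) (hl : 0 < l) (hx : 0 < x) :
    l ≤ m / x * Real.log 2 * 2 ^ waterfillRate m l x ∧
      (0 < waterfillRate m l x → l = m / x * Real.log 2 * 2 ^ waterfillRate m l x) := by
  have h2 : 0 < Real.log 2 := Real.log_pos one_lt_two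
  have hg : 0 < l * x / (Real.log 2 * m) := by positivity
  have key : l = m / x * Real.log 2 * (l * x / (Real.log 2 * m)) := by field_simp
  have hpow : (2 : ℝ) ^ Real.logb 2 (l * x / (Real.log 2 * m)) = l * x / (Real.log 2 * m) :=
    Real.rpow_logb two_pos (by norm_num) hg
  rw [waterfillRate_eq hm hl hx]
  constructor
  · calc l = m / x * Real.log 2 * 2 ^ Real.logb 2 (l * x / (Real.log 2 * m)) := by
          rw [hpow]; exact key
      _ ≤ _ := by
          gcongr
          · norm_num
          · exact le_max_left _ _
  · intro h
    have : 0 < Real.logb 2 (l * x / (Real.log 2 * m)) := by simpa using h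
    rw [max_eq_left this.le, hpow]
    exact key

/-- The first-order condition absorbs the linear term, leaving the remainder of the exponential
above its tangent at the water-filling rate. This remainder yields strict optimality. -/
lemma quality_add_le_lagrangeCost {m l x r : ℝ} (hm : 0 < m) (hl : 0 < l) (hx : 0 < x)
    (hr : 0 ≤ r) :
    quality m l x + m / x * 2 ^ waterfillRate m l x *
      (2 ^ (r - waterfillRate m l x) - 1 - (r - waterfillRate m l x) * Real.log 2)
      ≤ lagrangeCost m l x r := by
  obtain ⟨h1, h2⟩ := waterfillRate_optimal hm hl hx
  rw [quality]
  set w := waterfillRate m l x with hw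
  have hw0 : 0 ≤ w := waterfillRate_nonneg _ _ _
  -- Complementary slackness: either the rate is zero and `r - w` is non-negative, or the first
  -- factor vanishes.
  have h3 : (l - m / x * Real.log 2 * 2 ^ w) * (r - w) ≤ 0 := by
    rcases hw0.eq_or_lt with h | h
    · exact mul_nonpos_of_nonpos_of_nonneg (by linarith) (by linarith)
    · rw [sub_eq_zero.2 (h2 h), zero_mul]
  have h4 : (2 : ℝ) ^ r = 2 ^ w * 2 ^ (r - w) := by
    rw [← Real.rpow_add two_pos]; ring_nf
  simp only [lagrangeCost]
  rw [h4]
  nlinarith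

lemma two_rpow_sub_one_sub_pos {y : ℝ} (hy : y ≠ 0) : 0 < (2 : ℝ) ^ y - 1 - y * Real.log 2 := by
  have h2 : Real.log 2 ≠ 0 := (Real.log_pos one_lt_two).ne'
  have := Real.add_one_lt_exp (mul_ne_zero h2 hy)
  rw [Real.rpow_def_of_pos two_pos]
  linarith

lemma quality_lt_lagrangeCost {m l x r : ℝ} (hm : 0 < m) (hl : 0 < l) (hx : 0 < x)
    (hr : 0 ≤ r) (hne : r ≠ waterfillRate m l x) : quality m l x < lagrangeCost m l x r := by
  have h1 := quality_add_le_lagrangeCost hm hl hx hr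
  have h2 := two_rpow_sub_one_sub_pos (sub_ne_zero.2 hne)
  have h3 : 0 < m / x * 2 ^ waterfillRate m l x := by positivity
  nlinarith [mul_pos h3 h2]

lemma quality_le_lagrangeCost {m l x r : ℝ} (hm : 0 < m) (hl : 0 < l) (hx : 0 < x)
    (hr : 0 ≤ r) : quality m l x ≤ lagrangeCost m l x r := by
  by_cases h : r = waterfillRate m l x
  · rw [h, quality]
  · exact (quality_lt_lagrangeCost hm hl hx hr h).le

lemma quality_neg_iff {m l x : ℝ} (hm : 0 < m) (hl : 0 < l) (hx : 0 < x) :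
    quality m l x < 0 ↔ waterfillRate m l x ≠ 0 := by
  constructor
  · intro h h0
    simp [quality, lagrangeCost, h0] at h
  · intro h
    simpa [lagrangeCost] using quality_lt_lagrangeCost hm hl hx le_rfl (Ne.symm h)

/-- Envelope argument: the old rate is still admissible and costs no more under the larger
multiplier. -/
lemma quality_anti {m l l' x : ℝ} (hm : 0 < m) (hl : 0 < l) (hll : l ≤ l') (hx : 0 < x) :
    quality m l' x ≤ quality m l x := by
  have h1 := quality_le_lagrangeCost hm (hl.trans_le hll) hx (waterfillRate_nonneg m l x)
  have h2 := mul_le_mul_of_nonneg_right hll (waterfillRate_nonneg m l x)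
  refine h1.trans ?_
  simp only [quality, lagrangeCost]
  linarith

/-- Negative quality means a positive rate; keeping that rate at the better gain is strictly
cheaper. -/
lemma quality_lt_of_gain_lt {m l x x' : ℝ} (hm : 0 < m) (hl : 0 < l) (hx : 0 < x) (hxx : x < x')
    (hneg : quality m l x < 0) : quality m l x' < quality m l x := by
  have hw := (waterfillRate_nonneg m l x).lt_of_ne' ((quality_neg_iff hm hl hx).1 hneg)
  refine (quality_le_lagrangeCost hm hl (hx.trans hxx) hw.le).trans_lt ?_
  have h1 : 0 < (2 : ℝ) ^ waterfillRate m l x - 1 :=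
    sub_pos.2 (Real.one_lt_rpow one_lt_two hw)
  have h2 : m / x' < m / x := div_lt_div_of_pos_left hm hx hxx
  rw [quality]
  simp only [lagrangeCost]
  nlinarith [mul_lt_mul_of_pos_right h2 h1]

lemma neg_quality_le {m l x : ℝ} (hm : 0 < m) (hx : 0 < x) :
    -quality m l x ≤ l * waterfillRate m l x := by
  have h1 : 0 ≤ (2 : ℝ) ^ waterfillRate m l x - 1 :=
    sub_nonneg.2 (Real.one_le_rpow one_le_two (waterfillRate_nonneg m l x))
  have : 0 ≤ m / x * ((2 : ℝ) ^ waterfillRate m l x - 1) := by positivity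
  simp only [quality, lagrangeCost]
  linarith

lemma waterfillRate_mono {m l l' x : ℝ} (hl : 0 < l) (hll : l ≤ l') :
    waterfillRate m l x ≤ waterfillRate m l' x := by
  have := (Real.logb_le_logb one_lt_two hl (hl.trans_le hll)).2 hll
  exact max_le_max (by linarith) le_rfl

lemma waterfillRate_lt {m l l' x : ℝ} (hl : 0 < l) (hll : l < l') (h : 0 < waterfillRate m l x) :
    waterfillRate m l x < waterfillRate m l' x := by
  have := (Real.logb_lt_logb_iff one_lt_two hl (hl.trans hll)).2 hll
  rw [waterfillRate, lt_max_iff, or_iff_left (lt_irrefl _)] at h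
  rw [waterfillRate, waterfillRate, max_eq_left h.le]
  exact lt_max_of_lt_left (by linarith)

lemma eq_of_waterfillRate_eq {m l l' x : ℝ} (hl : 0 < l) (hl' : 0 < l')
    (h : 0 < waterfillRate m l x) (he : waterfillRate m l x = waterfillRate m l' x) : l = l' := by
  rcases lt_trichotomy l l' with h1 | h1 | h1
  · exact absurd he (waterfillRate_lt hl h1 h).ne
  · exact h1
  · exact absurd he (waterfillRate_lt hl' h1 (he ▸ h)).ne'

lemma waterfillRate_le {m l x : ℝ} (hm : 0 < m) (hx : 0 < x) :
    waterfillRate m l x ≤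
      |Real.logb 2 l| + |Real.logb 2 (Real.log 2 * m)| + Real.log (1 + x) / Real.log 2 := by
  have h2 : 0 < Real.log 2 := Real.log_pos one_lt_two
  have h3 : 0 ≤ Real.log (1 + x) / Real.log 2 := div_nonneg (Real.log_nonneg (by linarith)) h2.le
  have h4 : Real.logb 2 x ≤ Real.log (1 + x) / Real.log 2 := by
    rw [Real.logb]
    gcongr
    linarith
  refine max_le ?_ (by positivity)
  rw [Real.logb_div (by positivity) hx.ne']
  have := le_abs_self (Real.logb 2 l)
  have := neg_abs_le (Real.logb 2 (Real.log 2 * m))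
  linarith

/-- The power of a water-filling user in the state `x`. -/
noncomputable def waterfillPower (m l x : ℝ) : ℝ := 1 / x * ((2 : ℝ) ^ waterfillRate m l x - 1)

lemma waterfillPower_eq_zero {m l x : ℝ} (h : waterfillRate m l x = 0) :
    waterfillPower m l x = 0 := by simp [waterfillPower, h]

lemma waterfillPower_nonneg (m l : ℝ) {x : ℝ} (hx : 0 < x) :
    0 ≤ waterfillPower m l x :=
  mul_nonneg (by positivity)
    (sub_nonneg.2 (Real.one_le_rpow one_le_two (waterfillRate_nonneg m l x)))

/-- At a positive rate the first-order condition fixes `2 ^ w / x`. The bound is uniform in the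
gain, so powers are integrable even though `1 / x` need not be. -/
lemma waterfillPower_le {m l x : ℝ} (hm : 0 < m) (hl : 0 < l) (hx : 0 < x) :
    waterfillPower m l x ≤ l / (Real.log 2 * m) := by
  unfold waterfillPower
  have h2 : 0 < Real.log 2 := Real.log_pos one_lt_two
  have hp : 0 < l / (Real.log 2 * m) := by positivity
  rcases (waterfillRate_nonneg m l x).eq_or_lt with h | h
  · rw [← h]; simpa using hp.le
  · have h3 := (waterfillRate_optimal hm hl hx).2 h
    have h4 : l / (Real.log 2 * m) = 1 / x * 2 ^ waterfillRate m l x := by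
      rw [div_eq_iff (by positivity)]
      refine h3.trans ?_
      ring
    have : 0 < 1 / x := by positivity
    rw [h4, mul_sub]
    linarith

lemma continuousAt_waterfillRate (m x : ℝ) {l : ℝ} (hl : 0 < l) :
    ContinuousAt (fun l => waterfillRate m l x) l := by
  unfold waterfillRate Real.logb
  have := Real.continuousAt_log hl.ne'
  fun_prop

lemma continuousAt_waterfillPower (m x : ℝ) {l : ℝ} (hl : 0 < l) :
    ContinuousAt (fun l => waterfillPower m l x) l := by
  unfold waterfillPower
  have h := continuousAt_waterfillRate m x hl
  have : ContinuousAt (fun l => (2 : ℝ) ^ waterfillRate m l x) l :=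
    ContinuousAt.rpow continuousAt_const h (Or.inl two_ne_zero)
  fun_prop

lemma continuousAt_quality (m x : ℝ) {l : ℝ} (hl : 0 < l) :
    ContinuousAt (fun l => quality m l x) l := by
  have h := continuousAt_waterfillRate m x hl
  have : ContinuousAt (fun l => (2 : ℝ) ^ waterfillRate m l x) l :=
    ContinuousAt.rpow continuousAt_const h (Or.inl two_ne_zero)
  unfold quality lagrangeCost
  fun_prop

lemma measurable_waterfillRate (m l : ℝ) : Measurable (waterfillRate m l) := by
  unfold waterfillRate Real.logb
  fun_prop

lemma measurable_waterfillPower (m l : ℝ) : Measurable (waterfillPower m l) := by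
  have := measurable_waterfillRate m l
  unfold waterfillPower
  fun_prop

lemma measurable_quality (m l : ℝ) : Measurable (quality m l) := by
  have := measurable_waterfillRate m l
  unfold quality lagrangeCost
  fun_prop

end TDMA

/-! ### Sole best users and good states -/

namespace TDMA

variable {K : ℕ}

open Classical in
/-- The indicator of the event that user `k` is the only one with the smallest quality
indicator. -/
noncomputable def soleBest (mu lam h : Fin K → ℝ) (k : Fin K) : ℝ :=
  if ∀ j, j ≠ k → quality (mu k) (lam k) (h k) < quality (mu j) (lam j) (h j) then 1 else 0

/-- States with positive gains in which ties occur only between users with zero rate. -/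
structure IsGoodState (mu lam h : Fin K → ℝ) : Prop where
  pos : ∀ k, 0 < h k
  tie : ∀ i j, i ≠ j → quality (mu i) (lam i) (h i) = quality (mu j) (lam j) (h j) →
    0 ≤ quality (mu i) (lam i) (h i)

lemma soleBest_nonneg (mu lam h : Fin K → ℝ) (k : Fin K) : 0 ≤ soleBest mu lam h k := by
  unfold soleBest; split_ifs <;> norm_num

lemma soleBest_le_one (mu lam h : Fin K → ℝ) (k : Fin K) : soleBest mu lam h k ≤ 1 := by
  unfold soleBest; split_ifs <;> norm_num

lemma measurable_soleBest (mu lam : Fin K → ℝ) (k : Fin K) :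
    Measurable (fun h => soleBest mu lam h k) := by
  refine Measurable.ite ?_ measurable_const measurable_const
  have hq : ∀ j, Measurable (fun h : Fin K → ℝ => quality (mu j) (lam j) (h j)) := fun j =>
    (measurable_quality _ _).comp (measurable_pi_apply j)
  simp only [Set.ofPred_forall]
  exact MeasurableSet.iInter fun j => MeasurableSet.iInter fun _ => measurableSet_lt (hq _) (hq _)

section State

variable {mu lam h : Fin K → ℝ}

/-- In a good state any division of the time among the best users acts like `soleBest`. -/
lemma time_mul_eq (hmu : ∀ k, 0 < mu k) (hlam : ∀ k, 0 < lam k) (hg : IsGoodState mu lam h)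
    {t : Fin K → ℝ} (hsum : ∑ k, t k = 1)
    (hsupp : ∀ k, t k ≠ 0 → ∀ j, quality (mu k) (lam k) (h k) ≤ quality (mu j) (lam j) (h j))
    (k : Fin K) {f : ℝ} (hf : waterfillRate (mu k) (lam k) (h k) = 0 → f = 0) :
    t k * f = soleBest mu lam h k * f := by
  -- At zero rate both sides vanish; otherwise the quality is negative, and a good state excludes a
  -- tie at the minimum.
  by_cases hw : waterfillRate (mu k) (lam k) (h k) = 0
  · simp [hf hw]
  have hq := (quality_neg_iff (hmu k) (hlam k) (hg.pos k)).2 hw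
  congr 1
  unfold soleBest
  split_ifs with hs
  · rw [← hsum]
    refine (Finset.sum_eq_single k (fun j _ hj => ?_) (by simp)).symm
    by_contra h0
    exact absurd (hs j hj) (hsupp j h0 k).not_gt
  · push Not at hs
    obtain ⟨j, hj, hjk⟩ := hs
    by_contra h0
    exact absurd hq (hg.tie k j hj.symm ((hsupp k h0 j).antisymm hjk)).not_gt

/-- Giving all the time to one minimizer leaves the sum unchanged, by `time_mul_eq`, and turns it
into the minimal quality. -/
lemma sum_soleBest_mul_quality_le (hmu : ∀ k, 0 < mu k) (hlam : ∀ k, 0 < lam k)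
    (hg : IsGoodState mu lam h) (j : Fin K) :
    ∑ k, soleBest mu lam h k * quality (mu k) (lam k) (h k) ≤ quality (mu j) (lam j) (h j) := by
  have : Nonempty (Fin K) := ⟨j⟩
  obtain ⟨i, hi⟩ := Finite.exists_min (fun k => quality (mu k) (lam k) (h k))
  have hsupp : ∀ k, (Pi.single i (1 : ℝ) : Fin K → ℝ) k ≠ 0 →
      ∀ j, quality (mu k) (lam k) (h k) ≤ quality (mu j) (lam j) (h j) := by
    intro k hk
    obtain rfl : k = i := by
      by_contra hki
      exact hk (by simp [hki])
    exact hi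
  have h1 : ∀ k, soleBest mu lam h k * quality (mu k) (lam k) (h k) =
      (Pi.single i (1 : ℝ) : Fin K → ℝ) k * quality (mu k) (lam k) (h k) := fun k =>
    (time_mul_eq hmu hlam hg (by simp) hsupp k
      (fun hw => by simp [quality, lagrangeCost, hw])).symm
  simp only [h1]
  rw [Finset.sum_eq_single i (fun k _ hk => by simp [hk]) (by simp)]
  simpa using hi j

lemma soleBest_mul_quality (k : Fin K) : soleBest mu lam h k * quality (mu k) (lam k) (h k) =
    mu k * (soleBest mu lam h k * waterfillPower (mu k) (lam k) (h k)) -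
      lam k * (soleBest mu lam h k * waterfillRate (mu k) (lam k) (h k)) := by
  simp only [quality, lagrangeCost, waterfillPower]
  ring

lemma soleBest_mono {lam' : Fin K → ℝ} {k : Fin K} (hmu : ∀ k, 0 < mu k) (hlam : ∀ k, 0 < lam k)
    (hlam' : ∀ k, 0 < lam' k) (hh : ∀ k, 0 < h k) (hk : lam k ≤ lam' k)
    (ho : ∀ j, j ≠ k → lam' j ≤ lam j) : soleBest mu lam h k ≤ soleBest mu lam' h k := by
  unfold soleBest
  split_ifs with h1 h2
  · exact le_rfl
  · refine absurd (fun j hj => ?_) h2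
    exact (quality_anti (hmu k) (hlam k) hk (hh k)).trans_lt
      ((h1 j hj).trans_le (quality_anti (hmu j) (hlam' j) (ho j hj) (hh j)))
  · exact zero_le_one
  · exact le_rfl

/-- With a positive rate there is no tie at the minimum, so `soleBest` is locally constant in the
multipliers. At zero rate it may jump, but its factor tends to zero. -/
lemma tendsto_soleBest_mul (hmu : ∀ k, 0 < mu k) (hlam : ∀ k, 0 < lam k)
    (hg : IsGoodState mu lam h) (k : Fin K) {f : ℝ → ℝ} (hf : ContinuousAt f (lam k))
    (hz : waterfillRate (mu k) (lam k) (h k) = 0 → f (lam k) = 0) :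
    Filter.Tendsto (fun l : Fin K → ℝ => soleBest mu l h k * f (l k)) (nhds lam)
      (nhds (soleBest mu lam h k * f (lam k))) := by
  have hfl : Filter.Tendsto (fun l : Fin K → ℝ => f (l k)) (nhds lam) (nhds (f (lam k))) :=
    hf.tendsto.comp ((continuous_apply k).tendsto lam)
  have hql : ∀ j, Filter.Tendsto (fun l : Fin K → ℝ => quality (mu j) (l j) (h j)) (nhds lam)
      (nhds (quality (mu j) (lam j) (h j))) := fun j =>
    (continuousAt_quality (mu j) (h j) (hlam j)).tendsto.comp ((continuous_apply j).tendsto lam)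
  by_cases hw : waterfillRate (mu k) (lam k) (h k) = 0
  · rw [hz hw, mul_zero]
    rw [hz hw] at hfl
    refine squeeze_zero_norm (fun l => ?_) (by simpa using hfl.norm)
    rw [norm_mul, Real.norm_of_nonneg (soleBest_nonneg _ _ _ _)]
    exact mul_le_of_le_one_left (norm_nonneg _) (soleBest_le_one _ _ _ _)
  have hq := (quality_neg_iff (hmu k) (hlam k) (hg.pos k)).2 hw
  refine Filter.Tendsto.mul (tendsto_nhds_of_eventually_eq ?_) hfl
  by_cases hs : ∀ j, j ≠ k → quality (mu k) (lam k) (h k) < quality (mu j) (lam j) (h j)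
  · have : ∀ᶠ l in nhds lam, ∀ j, j ≠ k →
        quality (mu k) (l k) (h k) < quality (mu j) (l j) (h j) := by
      rw [Filter.eventually_all]
      intro j
      by_cases hj : j = k
      · simp [hj]
      · filter_upwards [(hql k).eventually_lt (hql j) (hs j hj)] with l hl _ using hl
    filter_upwards [this] with l hl
    rw [soleBest, soleBest, if_pos hl, if_pos hs]
  · have hs' := hs
    push Not at hs'
    obtain ⟨j, hj, hjk⟩ := hs'
    have hlt : quality (mu j) (lam j) (h j) < quality (mu k) (lam k) (h k) :=
      hjk.lt_of_ne fun he => absurd hq (hg.tie k j hj.symm he.symm).not_gt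
    filter_upwards [(hql j).eventually_lt (hql k) hlt] with l hl
    rw [soleBest, soleBest, if_neg hs, if_neg fun h => (h j hj).not_gt hl]

end State

/-! ### Null sets of ties and the reduction of averages -/

lemma ae_ne_zero_volume (k : Fin K) : ∀ᵐ h : Fin K → ℝ, h k ≠ 0 := by
  refine ae_mem_of_ae_add_linearMap_mem (LinearMap.single ℝ (fun _ : Fin K => ℝ) k) volume volume
    (s := {h | h k ≠ 0}) ((measurableSet_singleton 0).compl.preimage (measurable_pi_apply k)) ?_
  intro y
  rw [ae_iff]
  refine Set.Subsingleton.measure_zero (fun a ha b hb => ?_) _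
  simp at ha hb
  linarith

/-- Along a line in direction `i` the quality of `j` is fixed, while that of `i` is strictly
decreasing where negative. Each such line thus contains at most one bad point, and Fubini applies.
-/
lemma ae_no_tie_volume {mu lam : Fin K → ℝ} (hmu : ∀ k, 0 < mu k) (hlam : ∀ k, 0 < lam k)
    {i j : Fin K} (hij : i ≠ j) :
    ∀ᵐ h : Fin K → ℝ, ¬ (0 < h i ∧ quality (mu i) (lam i) (h i) = quality (mu j) (lam j) (h j) ∧
      quality (mu i) (lam i) (h i) < 0) := by
  have hq : ∀ j, Measurable (fun h : Fin K → ℝ => quality (mu j) (lam j) (h j)) := fun j =>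
    (measurable_quality _ _).comp (measurable_pi_apply j)
  refine ae_mem_of_ae_add_linearMap_mem (LinearMap.single ℝ (fun _ : Fin K => ℝ) i) volume volume
    (s := {h | ¬ (0 < h i ∧ quality (mu i) (lam i) (h i) = quality (mu j) (lam j) (h j) ∧
      quality (mu i) (lam i) (h i) < 0)}) ?_ ?_
  · exact ((measurableSet_lt measurable_const (measurable_pi_apply i)).inter
      ((measurableSet_eq_fun (hq i) (hq j)).inter
        (measurableSet_lt (hq i) measurable_const))).compl
  intro y
  rw [ae_iff]
  have key : ∀ a b, a < b →
      ¬ (0 < y i + a ∧ quality (mu i) (lam i) (y i + a) = quality (mu j) (lam j) (y j) ∧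
        quality (mu i) (lam i) (y i + a) < 0 ∧
        quality (mu i) (lam i) (y i + b) = quality (mu j) (lam j) (y j)) := by
    rintro a b hab ⟨h1, h2, h3, h4⟩
    have := quality_lt_of_gain_lt (hmu i) (hlam i) h1 (x' := y i + b) (by linarith) h3
    linarith
  refine Set.Subsingleton.measure_zero (fun a ha b hb => ?_) _
  simp [hij.symm] at ha hb
  rcases lt_trichotomy a b with h | h | h
  · exact absurd ⟨ha.1, ha.2.1, ha.2.2, hb.2.1⟩ (key a b h)
  · exact h
  · exact absurd ⟨hb.1, hb.2.1, hb.2.2, ha.2.1⟩ (key b a h)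

section Law

variable {nu : Measure (Fin K → ℝ)}

lemma ae_pos (hdens : nu ≪ volume) (hnonneg : ∀ᵐ h ∂nu, ∀ k, 0 ≤ h k) :
    ∀ᵐ h ∂nu, ∀ k, 0 < h k := by
  have := hdens.ae_le (ae_all_iff.2 fun k : Fin K => ae_ne_zero_volume k)
  filter_upwards [this, hnonneg] with h h1 h2 k
  exact (h2 k).lt_of_ne' (h1 k)

lemma ae_isGoodState (hdens : nu ≪ volume) (hnonneg : ∀ᵐ h ∂nu, ∀ k, 0 ≤ h k)
    {mu lam : Fin K → ℝ} (hmu : ∀ k, 0 < mu k) (hlam : ∀ k, 0 < lam k) :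
    ∀ᵐ h ∂nu, IsGoodState mu lam h := by
  have h1 : ∀ᵐ h : Fin K → ℝ, ∀ i j, i ≠ j → ¬ (0 < h i ∧
      quality (mu i) (lam i) (h i) = quality (mu j) (lam j) (h j) ∧
      quality (mu i) (lam i) (h i) < 0) := by
    simp only [ae_all_iff]
    exact fun i j hij => ae_no_tie_volume hmu hlam hij
  filter_upwards [hdens.ae_le h1, ae_pos hdens hnonneg] with h h1 h2
  exact ⟨h2, fun i j hij he => not_lt.1 fun hlt => h1 i j hij ⟨h2 i, he, hlt⟩⟩

/-- The average rates when only sole best users transmit. -/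
noncomputable def soleRate (nu : Measure (Fin K → ℝ)) (mu lam : Fin K → ℝ) (k : Fin K) : ℝ :=
  ∫ h, soleBest mu lam h k * waterfillRate (mu k) (lam k) (h k) ∂nu

/-- The average powers when only sole best users transmit. -/
noncomputable def solePower (nu : Measure (Fin K → ℝ)) (mu lam : Fin K → ℝ) (k : Fin K) : ℝ :=
  ∫ h, soleBest mu lam h k * waterfillPower (mu k) (lam k) (h k) ∂nu

lemma avgRate_eq_soleRate (hdens : nu ≪ volume) (hnonneg : ∀ᵐ h ∂nu, ∀ k, 0 ≤ h k)
    {mu lam : Fin K → ℝ} (hmu : ∀ k, 0 < mu k) (hlam : ∀ k, 0 < lam k)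
    {tau : (Fin K → ℝ) → (Fin K → ℝ) → Fin K → ℝ} (ht : IsGreedyRule mu tau) :
    avgRate nu mu tau lam = soleRate nu mu lam := by
  funext k
  refine integral_congr_ae ?_
  filter_upwards [ae_isGoodState hdens hnonneg hmu hlam] with h hg
  exact time_mul_eq hmu hlam hg (ht.tau_sum lam hlam h) (ht.tau_support lam hlam h) k id

lemma avgPower_eq_solePower (hdens : nu ≪ volume) (hnonneg : ∀ᵐ h ∂nu, ∀ k, 0 ≤ h k)
    {mu lam : Fin K → ℝ} (hmu : ∀ k, 0 < mu k) (hlam : ∀ k, 0 < lam k)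
    {tau : (Fin K → ℝ) → (Fin K → ℝ) → Fin K → ℝ} (ht : IsGreedyRule mu tau) :
    avgPower nu mu tau lam = solePower nu mu lam := by
  funext k
  refine integral_congr_ae ?_
  filter_upwards [ae_isGoodState hdens hnonneg hmu hlam] with h hg
  rw [← time_mul_eq hmu hlam hg (ht.tau_sum lam hlam h) (ht.tau_support lam hlam h) k
    waterfillPower_eq_zero, waterfillPower]
  ring

end Law

end TDMA

/-! ### Continuity, monotonicity and growth of average rates -/

namespace TDMA

variable {K : ℕ}

/-- Laws of fading states with a density, non-negative gains and finite average rates. -/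
structure IsFadingLaw (nu : Measure (Fin K → ℝ)) : Prop where
  dens : nu ≪ volume
  nonneg : ∀ᵐ h ∂nu, ∀ k, 0 ≤ h k
  log : ∀ k, Integrable (fun h : Fin K → ℝ => Real.log (1 + h k)) nu

namespace IsFadingLaw

variable {nu : Measure (Fin K → ℝ)} {mu lam : Fin K → ℝ}

lemma ae_pos (H : IsFadingLaw nu) : ∀ᵐ h ∂nu, ∀ k, 0 < h k := TDMA.ae_pos H.dens H.nonneg

lemma ae_good (H : IsFadingLaw nu) (hmu : ∀ k, 0 < mu k) (hlam : ∀ k, 0 < lam k) :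
    ∀ᵐ h ∂nu, IsGoodState mu lam h := ae_isGoodState H.dens H.nonneg hmu hlam

lemma integrable_waterfillRate [IsProbabilityMeasure nu] (H : IsFadingLaw nu)
    {m : ℝ} (hm : 0 < m) (l : ℝ) (k : Fin K) :
    Integrable (fun h : Fin K → ℝ => waterfillRate m l (h k)) nu := by
  refine Integrable.mono' (g := fun h => |Real.logb 2 l| + |Real.logb 2 (Real.log 2 * m)| +
      Real.log (1 + h k) / Real.log 2) ((integrable_const _).add ((H.log k).div_const _))
    ((measurable_waterfillRate m l).comp (measurable_pi_apply k)).aestronglyMeasurable ?_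
  filter_upwards [H.ae_pos] with h hh
  rw [Real.norm_of_nonneg (waterfillRate_nonneg _ _ _)]
  exact waterfillRate_le hm (hh k)

lemma integrable_waterfillPower [IsProbabilityMeasure nu] (H : IsFadingLaw nu)
    {m l : ℝ} (hm : 0 < m) (hl : 0 < l)
    (k : Fin K) : Integrable (fun h : Fin K → ℝ => waterfillPower m l (h k)) nu := by
  refine Integrable.mono' (g := fun _ => l / (Real.log 2 * m)) (integrable_const _)
    ((measurable_waterfillPower m l).comp (measurable_pi_apply k)).aestronglyMeasurable ?_
  filter_upwards [H.ae_pos] with h hh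
  rw [Real.norm_of_nonneg (waterfillPower_nonneg _ _ (hh k))]
  exact waterfillPower_le hm hl (hh k)

lemma integrable_soleBest_mul {f : (Fin K → ℝ) → ℝ} (hf : Integrable f nu) (k : Fin K) :
    Integrable (fun h => soleBest mu lam h k * f h) nu := by
  refine hf.bdd_mul (c := 1) (measurable_soleBest mu lam k).aestronglyMeasurable ?_
  filter_upwards with h
  rw [Real.norm_of_nonneg (soleBest_nonneg _ _ _ _)]
  exact soleBest_le_one _ _ _ _

lemma integrable_soleRate [IsProbabilityMeasure nu] (H : IsFadingLaw nu)
    (hmu : ∀ k, 0 < mu k) (k : Fin K) : Integrable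
    (fun h => soleBest mu lam h k * waterfillRate (mu k) (lam k) (h k)) nu :=
  integrable_soleBest_mul (H.integrable_waterfillRate (hmu k) _ k) k

lemma integrable_solePower [IsProbabilityMeasure nu] (H : IsFadingLaw nu)
    (hmu : ∀ k, 0 < mu k) (hlam : ∀ k, 0 < lam k)
    (k : Fin K) : Integrable
    (fun h => soleBest mu lam h k * waterfillPower (mu k) (lam k) (h k)) nu :=
  integrable_soleBest_mul (H.integrable_waterfillPower (hmu k) (hlam k) k) k

lemma continuousAt_integral (H : IsFadingLaw nu) (hmu : ∀ k, 0 < mu k) (hlam : ∀ k, 0 < lam k)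
    (k : Fin K) {g : ℝ → ℝ → ℝ} (hg : ∀ l, Measurable (g l))
    (hc : ∀ x, ContinuousAt (fun l => g l x) (lam k))
    (hz : ∀ x, waterfillRate (mu k) (lam k) x = 0 → g (lam k) x = 0) {b : ℝ → ℝ}
    (hb : ∀ l x, 0 < l → l ≤ lam k + 1 → 0 < x → ‖g l x‖ ≤ b x)
    (hint : Integrable (fun h : Fin K → ℝ => b (h k)) nu) :
    ContinuousAt (fun l => ∫ h, soleBest mu l h k * g (l k) (h k) ∂nu) lam := by
  have hev : ∀ᶠ l : Fin K → ℝ in nhds lam, 0 < l k ∧ l k < lam k + 1 := by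
    have hk := (continuous_apply k).tendsto lam
    exact (hk.eventually_const_lt (hlam k)).and (hk.eventually_lt_const (by linarith [hlam k]))
  refine tendsto_integral_filter_of_dominated_convergence (fun h => b (h k)) ?_ ?_ hint ?_
  · refine .of_forall fun l => Measurable.aestronglyMeasurable ?_
    exact (measurable_soleBest _ _ _).mul ((hg _).comp (measurable_pi_apply k))
  · filter_upwards [hev] with l hl
    filter_upwards [H.ae_pos] with h hh
    rw [norm_mul, Real.norm_of_nonneg (soleBest_nonneg _ _ _ _)]
    exact (mul_le_of_le_one_left (norm_nonneg _) (soleBest_le_one _ _ _ _)).trans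
      (hb _ _ hl.1 hl.2.le (hh k))
  · filter_upwards [H.ae_good hmu hlam] with h hh
    exact tendsto_soleBest_mul hmu hlam hh k (f := fun l => g l (h k)) (hc _) (hz _)

lemma continuousAt_soleRate [IsProbabilityMeasure nu] (H : IsFadingLaw nu)
    (hmu : ∀ k, 0 < mu k) (hlam : ∀ k, 0 < lam k) :
    ContinuousAt (soleRate nu mu) lam := by
  refine continuousAt_pi.2 fun k => H.continuousAt_integral hmu hlam k (g := waterfillRate (mu k))
    (b := waterfillRate (mu k) (lam k + 1)) (measurable_waterfillRate _)
    (fun x => continuousAt_waterfillRate _ x (hlam k)) (fun _ => id) ?_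
    (H.integrable_waterfillRate (hmu k) _ k)
  intro l x hl hll _
  rw [Real.norm_of_nonneg (waterfillRate_nonneg _ _ _)]
  exact waterfillRate_mono hl hll

lemma continuousAt_solePower [IsProbabilityMeasure nu] (H : IsFadingLaw nu)
    (hmu : ∀ k, 0 < mu k) (hlam : ∀ k, 0 < lam k) :
    ContinuousAt (solePower nu mu) lam := by
  refine continuousAt_pi.2 fun k => H.continuousAt_integral hmu hlam k (g := waterfillPower (mu k))
    (b := fun _ => (lam k + 1) / (Real.log 2 * mu k)) (measurable_waterfillPower _)
    (fun x => continuousAt_waterfillPower _ x (hlam k)) (fun _ => waterfillPower_eq_zero) ?_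
    (integrable_const _)
  intro l x hl hll hx
  have h2 : 0 < Real.log 2 := Real.log_pos one_lt_two
  have hm := hmu k
  rw [Real.norm_of_nonneg (waterfillPower_nonneg _ _ hx)]
  exact (waterfillPower_le hm hl hx).trans (by gcongr)

lemma soleRate_mono [IsProbabilityMeasure nu] (H : IsFadingLaw nu)
    (hmu : ∀ k, 0 < mu k) (hlam : ∀ k, 0 < lam k)
    {lam' : Fin K → ℝ} (hlam' : ∀ k, 0 < lam' k) {k : Fin K} (hk : lam k ≤ lam' k)
    (ho : ∀ j, j ≠ k → lam' j ≤ lam j) : soleRate nu mu lam k ≤ soleRate nu mu lam' k := by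
  refine integral_mono_ae (H.integrable_soleRate hmu k) (H.integrable_soleRate hmu k) ?_
  filter_upwards [H.ae_pos] with h hh
  exact mul_le_mul (soleBest_mono hmu hlam hlam' hh hk ho) (waterfillRate_mono (hlam k) hk)
    (waterfillRate_nonneg _ _ _) (soleBest_nonneg _ _ _ _)

/-- Wherever user `k` transmitted before, it still does, at a strictly higher rate. Equal averages
would therefore force it to be silent almost surely. -/
lemma soleRate_strictMono [IsProbabilityMeasure nu] (H : IsFadingLaw nu)
    (hmu : ∀ k, 0 < mu k) (hlam : ∀ k, 0 < lam k)
    {lam' : Fin K → ℝ} (hlam' : ∀ k, 0 < lam' k) {k : Fin K} (hk : lam k < lam' k)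
    (ho : ∀ j, j ≠ k → lam' j ≤ lam j) (hpos : 0 < soleRate nu mu lam k) :
    soleRate nu mu lam k < soleRate nu mu lam' k := by
  refine (H.soleRate_mono hmu hlam hlam' hk.le ho).lt_of_ne fun he => hpos.ne' ?_
  have hi := H.integrable_soleRate (lam := lam) hmu k
  have hi' := H.integrable_soleRate (lam := lam') hmu k
  have h0 : ∫ h, (soleBest mu lam' h k * waterfillRate (mu k) (lam' k) (h k) -
      soleBest mu lam h k * waterfillRate (mu k) (lam k) (h k)) ∂nu = 0 := by
    refine (integral_sub hi' hi).trans ?_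
    exact sub_eq_zero.2 he.symm
  have hle : ∀ᵐ h ∂nu, soleBest mu lam h k * waterfillRate (mu k) (lam k) (h k) ≤
      soleBest mu lam' h k * waterfillRate (mu k) (lam k) (h k) := by
    filter_upwards [H.ae_pos] with h hh
    exact mul_le_mul_of_nonneg_right (soleBest_mono hmu hlam hlam' hh hk.le ho)
      (waterfillRate_nonneg _ _ _)
  have h0 := (integral_eq_zero_iff_of_nonneg_ae ?_ (hi'.sub hi)).1 h0
  · refine integral_eq_zero_of_ae ?_
    filter_upwards [h0, hle] with h h1 h2
    simp only [Pi.zero_apply, Pi.sub_apply] at h1 ⊢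
    by_contra hne
    have hw : 0 < waterfillRate (mu k) (lam k) (h k) :=
      (waterfillRate_nonneg _ _ _).lt_of_ne' (right_ne_zero_of_mul hne)
    have hs : 0 < soleBest mu lam h k :=
      (soleBest_nonneg _ _ _ _).lt_of_ne' (left_ne_zero_of_mul hne)
    have hs' : 0 < soleBest mu lam' h k := hs.trans_le (le_of_mul_le_mul_right h2 hw)
    have := mul_lt_mul_of_pos_left (waterfillRate_lt (hlam k) hk hw) hs'
    linarith
  · filter_upwards [hle] with h h2
    have := mul_le_mul_of_nonneg_left (waterfillRate_mono (m := mu k) (x := h k) (hlam k) hk.le)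
      (soleBest_nonneg mu lam' h k)
    simp only [Pi.zero_apply, Pi.sub_apply]
    linarith

/-- Dropping the competition bounds the rate by the single-user one, which tends to zero with the
multiplier; hence `δ` is uniform in the other users. -/
lemma exists_soleRate_lt [IsProbabilityMeasure nu] (H : IsFadingLaw nu)
    (hmu : ∀ k, 0 < mu k) (k : Fin K) {ε : ℝ}
    (hε : 0 < ε) : ∃ δ > 0, ∀ l : Fin K → ℝ, (∀ j, 0 < l j) → l k ≤ δ → soleRate nu mu l k < ε := by
  have ht : Filter.Tendsto (fun l => ∫ h : Fin K → ℝ, waterfillRate (mu k) l (h k) ∂nu)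
      (nhdsWithin 0 (Set.Ioi 0)) (nhds (∫ _ : Fin K → ℝ, (0 : ℝ) ∂nu)) := by
    refine tendsto_integral_filter_of_dominated_convergence
      (fun h => waterfillRate (mu k) 1 (h k)) ?_ ?_ (H.integrable_waterfillRate (hmu k) 1 k) ?_
    · exact .of_forall fun l =>
        ((measurable_waterfillRate _ l).comp (measurable_pi_apply k)).aestronglyMeasurable
    · filter_upwards [Ioo_mem_nhdsGT one_pos] with l hl
      filter_upwards with h
      rw [Real.norm_of_nonneg (waterfillRate_nonneg _ _ _)]
      exact waterfillRate_mono hl.1 hl.2.le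
    · filter_upwards [H.ae_pos] with h hh
      have hm := hmu k
      have hx := hh k
      have h2 : 0 < Real.log 2 := Real.log_pos one_lt_two
      have hp : 0 < Real.log 2 * mu k / h k := by positivity
      refine tendsto_nhds_of_eventually_eq ?_
      filter_upwards [Ioo_mem_nhdsGT hp] with l hl
      exact max_eq_right (sub_nonpos.2 (Real.logb_le_logb_of_le one_lt_two hl.1 hl.2.le))
  rw [integral_zero] at ht
  obtain ⟨δ, hδ, hd⟩ := ((ht.eventually_lt_const hε).and self_mem_nhdsWithin).exists
  refine ⟨δ, hd, fun l hl hlk => lt_of_le_of_lt ?_ hδ⟩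
  refine integral_mono (H.integrable_soleRate hmu k) (H.integrable_waterfillRate (hmu k) δ k) ?_
  intro h
  exact (mul_le_of_le_one_left (waterfillRate_nonneg _ _ _) (soleBest_le_one _ _ _ _)).trans
    (waterfillRate_mono (hl k) hlk)

lemma exists_half_lt_measure [IsProbabilityMeasure nu] (H : IsFadingLaw nu) (k : Fin K) :
    ∃ δ > 0, 1 / 2 < nu.real {h | δ < h k} := by
  have hmono : Monotone (fun n : ℕ => {h : Fin K → ℝ | 1 / ((n : ℝ) + 1) < h k}) := by
    intro a b hab h hh
    have hh' : 1 / ((a : ℝ) + 1) < h k := hh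
    exact (Nat.one_div_le_one_div hab).trans_lt hh'
  have ht := tendsto_measure_iUnion_atTop (μ := nu) hmono
  have h1 : nu (⋃ n : ℕ, {h : Fin K → ℝ | 1 / ((n : ℝ) + 1) < h k}) = 1 := by
    rw [← measure_univ (μ := nu)]
    refine measure_congr (Filter.eventuallyEq_univ.2 ?_)
    filter_upwards [H.ae_pos] with h hh
    exact Set.mem_iUnion.2 (exists_nat_one_div_lt (hh k))
  rw [h1] at ht
  have ht' := (ENNReal.tendsto_toReal ENNReal.one_ne_top).comp ht
  obtain ⟨n, hn⟩ := (ht'.eventually_const_lt (u := 1 / 2) (by norm_num)).exists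
  exact ⟨_, Nat.one_div_pos_of_nat, hn⟩

/-- Let user `i` have the largest multiplier and consider rate `r` for it when its gain exceeds `δ
i`. The cost of power there is at most `l i`, so minus the minimal quality is at least `l i * (r -
1)`. It is also at most `l i` times the total rate. -/
lemma exists_lt_sum_soleRate [IsProbabilityMeasure nu] (H : IsFadingLaw nu)
    (hmu : ∀ k, 0 < mu k) (C : ℝ) : ∃ B : ℝ, ∀ l : Fin K → ℝ, (∀ j, 0 < l j) →
      ∀ k, B < l k → C < ∑ j, soleRate nu mu l j := by
  choose δ hδ hA using fun k => H.exists_half_lt_measure k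
  -- Chosen so that `r - 1`, on an event of probability above one half, averages to more than `C`.
  set r : ℝ := 2 * |C| + 2 with hr
  have hr0 : 0 < r := by positivity
  have hb0 : ∀ k, 0 ≤ mu k / δ k * (2 : ℝ) ^ r := fun k => by
    have := hmu k; have := hδ k; positivity
  refine ⟨∑ k, mu k / δ k * (2 : ℝ) ^ r, fun l hl k hk => ?_⟩
  have : Nonempty (Fin K) := ⟨k⟩
  obtain ⟨i, hi⟩ := Finite.exists_max l
  have hBi : mu i / δ i * (2 : ℝ) ^ r < l i :=
    (Finset.single_le_sum (fun k _ => hb0 k) (Finset.mem_univ i)).trans_lt (hk.trans_le (hi k))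
  set A : Set (Fin K → ℝ) := {h | δ i < h i} with hAdef
  have hAm : MeasurableSet A := measurableSet_lt measurable_const (measurable_pi_apply i)
  have hle : ∀ᵐ h ∂nu, A.indicator (fun _ => r - 1) h ≤
      ∑ j, soleBest mu l h j * waterfillRate (mu j) (l j) (h j) := by
    filter_upwards [H.ae_good hmu hl] with h hg
    by_cases hh : h ∈ A
    · rw [Set.indicator_of_mem hh]
      have hq := quality_le_lagrangeCost (hmu i) (hl i) (hg.pos i) hr0.le
      have h1 : mu i / h i * ((2 : ℝ) ^ r - 1) ≤ l i := by
        refine le_trans ?_ hBi.le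
        have := hδ i
        have := hmu i
        have := hg.pos i
        have : mu i / h i ≤ mu i / δ i := div_le_div_of_nonneg_left (by linarith) (by linarith)
          (le_of_lt hh)
        refine mul_le_mul this (by linarith) (sub_nonneg.2 (Real.one_le_rpow one_le_two hr0.le))
          (by positivity)
      have h2 : ∑ j, -(soleBest mu l h j * quality (mu j) (l j) (h j)) ≤
          l i * ∑ j, soleBest mu l h j * waterfillRate (mu j) (l j) (h j) := by
        rw [Finset.mul_sum]
        refine Finset.sum_le_sum fun j _ => ?_
        have h3 := neg_quality_le (l := l j) (hmu j) (hg.pos j)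
        have h4 := mul_le_mul_of_nonneg_right (hi j)
          (waterfillRate_nonneg (mu j) (l j) (h j))
        have := mul_le_mul_of_nonneg_left (h3.trans h4) (soleBest_nonneg mu l h j)
        linarith
      rw [Finset.sum_neg_distrib] at h2
      have h5 := sum_soleBest_mul_quality_le hmu hl hg i
      simp only [lagrangeCost] at hq
      refine le_of_mul_le_mul_left ?_ (hl i)
      linarith
    · rw [Set.indicator_of_notMem hh]
      exact Finset.sum_nonneg fun j _ =>
        mul_nonneg (soleBest_nonneg _ _ _ _) (waterfillRate_nonneg _ _ _)
  have hint := integral_mono_ae ((integrable_const (r - 1)).indicator hAm)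
    (integrable_finsetSum _ fun j _ => H.integrable_soleRate (lam := l) hmu j) hle
  rw [integral_finsetSum _ fun j _ => H.integrable_soleRate (lam := l) hmu j,
    integral_indicator_const _ hAm, smul_eq_mul] at hint
  have h6 := hA i
  have h7 := le_abs_self C
  have h8 := abs_nonneg C
  calc C < nu.real A * (r - 1) := by nlinarith
    _ ≤ _ := hint

end IsFadingLaw

end TDMA

/-! ### Lagrangian duality and optimal powers -/

namespace TDMA

variable {K : ℕ} {mu lam : Fin K → ℝ}

section State

variable {h t r : Fin K → ℝ}

lemma sum_time_mul_excess :
    ∑ k, (mu k * (t k / h k * ((2 : ℝ) ^ r k - 1)) - lam k * (t k * r k)) =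
      ∑ k, t k * lagrangeCost (mu k) (lam k) (h k) (r k) := by
  refine Finset.sum_congr rfl fun k _ => ?_
  simp only [lagrangeCost]
  ring

lemma sum_soleBest_mul_quality_le_lagrangeCost (hmu : ∀ k, 0 < mu k) (hlam : ∀ k, 0 < lam k)
    (hg : IsGoodState mu lam h) {k : Fin K} {x : ℝ} (hx : 0 ≤ x) :
    ∑ j, soleBest mu lam h j * quality (mu j) (lam j) (h j) ≤
      lagrangeCost (mu k) (lam k) (h k) x :=
  (sum_soleBest_mul_quality_le hmu hlam hg k).trans
    (quality_le_lagrangeCost (hmu k) (hlam k) (hg.pos k) hx)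

/-- The greedy allocation minimizes the Lagrangian in every state. -/
lemma soleBest_lagrangian_le (hmu : ∀ k, 0 < mu k) (hlam : ∀ k, 0 < lam k)
    (hg : IsGoodState mu lam h) (ht : ∀ k, 0 ≤ t k) (hsum : ∑ k, t k = 1) (hr : ∀ k, 0 ≤ r k) :
    ∑ j, soleBest mu lam h j * quality (mu j) (lam j) (h j) ≤
      ∑ k, t k * lagrangeCost (mu k) (lam k) (h k) (r k) := by
  rw [← one_mul (∑ j, soleBest mu lam h j * quality (mu j) (lam j) (h j)), ← hsum,
    Finset.sum_mul]
  exact Finset.sum_le_sum fun k _ => mul_le_mul_of_nonneg_left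
    (sum_soleBest_mul_quality_le_lagrangeCost hmu hlam hg (hr k)) (ht k)

/-- An allocation that minimizes the Lagrangian is greedy. -/
lemma greedy_of_lagrangian_eq (hmu : ∀ k, 0 < mu k) (hlam : ∀ k, 0 < lam k)
    (hg : IsGoodState mu lam h) (ht : ∀ k, 0 ≤ t k) (hsum : ∑ k, t k = 1) (hr : ∀ k, 0 ≤ r k)
    (he : ∑ k, t k * lagrangeCost (mu k) (lam k) (h k) (r k) =
      ∑ j, soleBest mu lam h j * quality (mu j) (lam j) (h j)) (k : Fin K) (hk : t k ≠ 0) :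
    r k = waterfillRate (mu k) (lam k) (h k) ∧
      ∀ j, quality (mu k) (lam k) (h k) ≤ quality (mu j) (lam j) (h j) := by
  set q := ∑ j, soleBest mu lam h j * quality (mu j) (lam j) (h j) with hq
  have hle : ∀ k, q ≤ lagrangeCost (mu k) (lam k) (h k) (r k) := fun k =>
    sum_soleBest_mul_quality_le_lagrangeCost hmu hlam hg (hr k)
  have h0 : ∑ k, t k * (lagrangeCost (mu k) (lam k) (h k) (r k) - q) = 0 := by
    simp only [mul_sub, Finset.sum_sub_distrib]
    rw [he, ← Finset.sum_mul, hsum, one_mul, sub_self]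
  have h1 := (Finset.sum_eq_zero_iff_of_nonneg
    fun k _ => mul_nonneg (ht k) (sub_nonneg.2 (hle k))).1 h0 k (Finset.mem_univ k)
  have h2 : lagrangeCost (mu k) (lam k) (h k) (r k) = q :=
    sub_eq_zero.1 ((mul_eq_zero.1 h1).resolve_left hk)
  have h3 := sum_soleBest_mul_quality_le hmu hlam hg
  constructor
  · by_contra hne
    have := quality_lt_lagrangeCost (hmu k) (hlam k) (hg.pos k) (hr k) hne
    linarith [h3 k]
  · intro j
    have := quality_le_lagrangeCost (hmu k) (hlam k) (hg.pos k) (hr k)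
    linarith [h3 j]

end State

namespace IsFadingLaw

variable {nu : Measure (Fin K → ℝ)}

/-- Weak duality, with the case of equality. -/
theorem duality [IsProbabilityMeasure nu] (H : IsFadingLaw nu)
    (hmu : ∀ k, 0 < mu k) (hlam : ∀ k, 0 < lam k)
    {tau r : (Fin K → ℝ) → Fin K → ℝ} (hpol : MeetsRates nu (soleRate nu mu lam) tau r)
    {p : Fin K → ℝ} (hp : p ∈ supportedPowers nu tau r) :
    ∑ k, mu k * solePower nu mu lam k ≤ ∑ k, mu k * p k ∧
      (∑ k, mu k * p k ≤ ∑ k, mu k * solePower nu mu lam k → p = solePower nu mu lam ∧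
        ∀ᵐ h ∂nu, ∀ k, tau h k ≠ 0 → r h k = waterfillRate (mu k) (lam k) (h k)) := by
  obtain ⟨hP, hrate⟩ := hpol
  set X : Fin K → (Fin K → ℝ) → ℝ := fun k h => tau h k / h k * ((2 : ℝ) ^ r h k - 1) with hX
  set Y : Fin K → (Fin K → ℝ) → ℝ := fun k h => tau h k * r h k with hY
  set q : (Fin K → ℝ) → ℝ := fun h =>
    ∑ j, soleBest mu lam h j * quality (mu j) (lam j) (h j) with hq
  have htm : ∀ k, Measurable fun h => tau h k := fun k => measurable_pi_iff.1 hP.measurable_tau k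
  have hrm : ∀ k, Measurable fun h => r h k := fun k => measurable_pi_iff.1 hP.measurable_r k
  have hXm : ∀ k, Measurable (X k) := fun k =>
    ((htm k).div (measurable_pi_apply k)).mul ((measurable_const.pow (hrm k)).sub_const 1)
  have hYm : ∀ k, Measurable (Y k) := fun k => (htm k).mul (hrm k)
  have hX0 : ∀ k, 0 ≤ᵐ[nu] X k := by
    intro k
    filter_upwards [H.ae_pos] with h hh
    exact mul_nonneg (div_nonneg (hP.tau_nonneg h k) (hh k).le)
      (sub_nonneg.2 (Real.one_le_rpow one_le_two (hP.r_nonneg h k)))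
  have hY0 : ∀ k h, 0 ≤ Y k h := fun k h => mul_nonneg (hP.tau_nonneg h k) (hP.r_nonneg h k)
  have hXi : ∀ k, Integrable (X k) nu := fun k =>
    ⟨(hXm k).aestronglyMeasurable, (hasFiniteIntegral_iff_ofReal (hX0 k)).2
      ((hp k).2.trans_lt ENNReal.ofReal_lt_top)⟩
  have hXp : ∀ k, ∫ h, X k h ∂nu ≤ p k := fun k => by
    rw [← ENNReal.ofReal_le_ofReal_iff (hp k).1,
      ofReal_integral_eq_lintegral_ofReal (hXi k) (hX0 k)]
    exact (hp k).2
  have hq_eq : ∀ h, q h = ∑ k, (mu k * (soleBest mu lam h k * waterfillPower (mu k) (lam k) (h k)) -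
      lam k * (soleBest mu lam h k * waterfillRate (mu k) (lam k) (h k))) := fun h =>
    Finset.sum_congr rfl fun k _ => soleBest_mul_quality k
  have hqi' : ∀ k, Integrable (fun h =>
      mu k * (soleBest mu lam h k * waterfillPower (mu k) (lam k) (h k)) -
      lam k * (soleBest mu lam h k * waterfillRate (mu k) (lam k) (h k))) nu := fun k =>
    ((H.integrable_solePower hmu hlam k).const_mul _).sub
      ((H.integrable_soleRate hmu k).const_mul _)
  have hqi : Integrable q nu := by
    simp only [funext hq_eq]
    exact integrable_finsetSum _ fun k _ => hqi' k
  have hqint : ∫ h, q h ∂nu =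
      ∑ k, (mu k * solePower nu mu lam k - lam k * soleRate nu mu lam k) := by
    simp only [hq_eq]
    rw [integral_finsetSum _ fun k _ => hqi' k]
    refine Finset.sum_congr rfl fun k _ => ?_
    rw [integral_sub ((H.integrable_solePower hmu hlam k).const_mul _)
      ((H.integrable_soleRate hmu k).const_mul _), integral_const_mul, integral_const_mul]
    rfl
  have hle : ∀ᵐ h ∂nu, q h ≤ ∑ k, (mu k * X k h - lam k * Y k h) := by
    filter_upwards [H.ae_good hmu hlam] with h hg
    rw [sum_time_mul_excess]
    exact soleBest_lagrangian_le hmu hlam hg (hP.tau_nonneg h) (hP.tau_sum h) (hP.r_nonneg h)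
  -- Finite rates are not assumed of a policy: the Lagrangian inequality bounds them by the
  -- integrable powers minus `q`.
  have hYi : ∀ k, Integrable (Y k) nu := by
    intro k
    refine Integrable.mono' (g := fun h => (lam k)⁻¹ * (∑ j, mu j * X j h - q h))
      (((integrable_finsetSum _ fun j _ => (hXi j).const_mul _).sub hqi).const_mul _)
      (hYm k).aestronglyMeasurable ?_
    filter_upwards [hle] with h hh
    rw [Real.norm_of_nonneg (hY0 k h), le_inv_mul_iff₀ (hlam k)]
    rw [Finset.sum_sub_distrib] at hh
    have := Finset.single_le_sum (f := fun j => lam j * Y j h)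
      (fun j _ => mul_nonneg (hlam j).le (hY0 j h)) (Finset.mem_univ k)
    linarith
  have hYR : ∀ k, soleRate nu mu lam k ≤ ∫ h, Y k h ∂nu := fun k => by
    rw [← ENNReal.ofReal_le_ofReal_iff (integral_nonneg (hY0 k)),
      ofReal_integral_eq_lintegral_ofReal (hYi k) (.of_forall (hY0 k))]
    exact hrate k
  have hLi : ∀ k, Integrable (fun h => mu k * X k h - lam k * Y k h) nu := fun k =>
    ((hXi k).const_mul _).sub ((hYi k).const_mul _)
  have hLint : ∫ h, ∑ k, (mu k * X k h - lam k * Y k h) ∂nu =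
      ∑ k, (mu k * ∫ h, X k h ∂nu - lam k * ∫ h, Y k h ∂nu) := by
    rw [integral_finsetSum _ fun k _ => hLi k]
    refine Finset.sum_congr rfl fun k _ => ?_
    rw [integral_sub ((hXi k).const_mul _) ((hYi k).const_mul _), integral_const_mul,
      integral_const_mul]
  have hLs := integrable_finsetSum Finset.univ fun k _ => hLi k
  have hmain := integral_mono_ae hqi hLs hle
  have hmain' := hmain
  rw [hqint, hLint, Finset.sum_sub_distrib, Finset.sum_sub_distrib] at hmain'
  have h1 : ∑ k, mu k * ∫ h, X k h ∂nu ≤ ∑ k, mu k * p k :=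
    Finset.sum_le_sum fun k _ => mul_le_mul_of_nonneg_left (hXp k) (hmu k).le
  have h2 : ∑ k, lam k * soleRate nu mu lam k ≤ ∑ k, lam k * ∫ h, Y k h ∂nu :=
    Finset.sum_le_sum fun k _ => mul_le_mul_of_nonneg_left (hYR k) (hlam k).le
  refine ⟨by linarith, fun hopt => ?_⟩
  -- Optimal cost closes the duality gap, so the policy minimizes the Lagrangian in almost every
  -- state.
  have hgap : ∫ h, (∑ k, (mu k * X k h - lam k * Y k h) - q h) ∂nu = 0 := by
    rw [integral_sub hLs hqi, hqint, hLint, Finset.sum_sub_distrib, Finset.sum_sub_distrib]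
    linarith
  have hae := (integral_eq_zero_iff_of_nonneg_ae (by
    filter_upwards [hle] with h hh using sub_nonneg.2 hh) (hLs.sub hqi)).1 hgap
  have hgreedy : ∀ᵐ h ∂nu, ∀ k, tau h k ≠ 0 → r h k = waterfillRate (mu k) (lam k) (h k) ∧
      ∀ j, quality (mu k) (lam k) (h k) ≤ quality (mu j) (lam j) (h j) := by
    filter_upwards [hae, H.ae_good hmu hlam] with h hh hg
    refine greedy_of_lagrangian_eq hmu hlam hg (hP.tau_nonneg h) (hP.tau_sum h) (hP.r_nonneg h) ?_
    rw [← sum_time_mul_excess]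
    exact sub_eq_zero.1 hh
  refine ⟨funext fun k => ?_, hgreedy.mono fun h hh k hk => (hh k hk).1⟩
  have hXsole : ∫ h, X k h ∂nu = solePower nu mu lam k := by
    refine integral_congr_ae ?_
    filter_upwards [hgreedy, H.ae_good hmu hlam] with h hh hg
    rw [← time_mul_eq hmu hlam hg (hP.tau_sum h) (fun k hk => (hh k hk).2) k waterfillPower_eq_zero]
    by_cases hk : tau h k = 0
    · simp [hX, hk]
    · simp only [hX, waterfillPower, (hh k hk).1]
      ring
  -- Positive weights turn equality of the weighted sums into equality for each user, so `p` has no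
  -- slack.
  have heq : ∑ k, mu k * ∫ h, X k h ∂nu = ∑ k, mu k * p k := le_antisymm h1 (by linarith)
  have := (Finset.sum_eq_sum_iff_of_le
    fun k _ => mul_le_mul_of_nonneg_left (hXp k) (hmu k).le).1 heq k (Finset.mem_univ k)
  rw [← hXsole]
  exact (mul_left_cancel₀ (hmu k).ne' this).symm

lemma isPolicy_greedy {tau : (Fin K → ℝ) → (Fin K → ℝ) → Fin K → ℝ} (ht : IsGreedyRule mu tau)
    (hlam : ∀ k, 0 < lam k) :
    IsPolicy (tau lam) (fun h k => waterfillRate (mu k) (lam k) (h k)) where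
  measurable_tau := ht.measurable_tau lam hlam
  measurable_r := measurable_pi_lambda _ fun k =>
    (measurable_waterfillRate _ _).comp (measurable_pi_apply k)
  tau_nonneg := ht.tau_nonneg lam hlam
  tau_sum := ht.tau_sum lam hlam
  r_nonneg _ _ := waterfillRate_nonneg _ _ _

lemma meetsRates_greedy [IsProbabilityMeasure nu] (H : IsFadingLaw nu)
    (hmu : ∀ k, 0 < mu k) (hlam : ∀ k, 0 < lam k)
    {tau : (Fin K → ℝ) → (Fin K → ℝ) → Fin K → ℝ} (ht : IsGreedyRule mu tau) :
    MeetsRates nu (soleRate nu mu lam) (tau lam)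
      (fun h k => waterfillRate (mu k) (lam k) (h k)) := by
  refine ⟨isPolicy_greedy ht hlam, fun k => ?_⟩
  rw [soleRate, ofReal_integral_eq_lintegral_ofReal (H.integrable_soleRate hmu k)
    (.of_forall fun h => mul_nonneg (soleBest_nonneg _ _ _ _) (waterfillRate_nonneg _ _ _))]
  refine (lintegral_congr_ae ?_).le
  filter_upwards [H.ae_good hmu hlam] with h hg
  rw [time_mul_eq hmu hlam hg (ht.tau_sum lam hlam h) (ht.tau_support lam hlam h) k (fun h => h)]

lemma solePower_nonneg (H : IsFadingLaw nu) (k : Fin K) : 0 ≤ solePower nu mu lam k := by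
  refine integral_nonneg_of_ae ?_
  filter_upwards [H.ae_pos] with h hh
  exact mul_nonneg (soleBest_nonneg _ _ _ _) (waterfillPower_nonneg _ _ (hh k))

lemma solePower_mem_supportedPowers [IsProbabilityMeasure nu] (H : IsFadingLaw nu)
    (hmu : ∀ k, 0 < mu k)
    (hlam : ∀ k, 0 < lam k) {tau : (Fin K → ℝ) → (Fin K → ℝ) → Fin K → ℝ}
    (ht : IsGreedyRule mu tau) : solePower nu mu lam ∈ supportedPowers nu (tau lam)
      (fun h k => waterfillRate (mu k) (lam k) (h k)) := by
  refine fun k => ⟨H.solePower_nonneg k, ?_⟩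
  rw [solePower, ofReal_integral_eq_lintegral_ofReal (H.integrable_solePower hmu hlam k)]
  · refine (lintegral_congr_ae ?_).le
    filter_upwards [H.ae_good hmu hlam] with h hg
    rw [← time_mul_eq hmu hlam hg (ht.tau_sum lam hlam h) (ht.tau_support lam hlam h) k
      waterfillPower_eq_zero, waterfillPower]
    ring_nf
  · filter_upwards [H.ae_pos] with h hh
    exact mul_nonneg (soleBest_nonneg _ _ _ _) (waterfillPower_nonneg _ _ (hh k))

/-- The greedy allocation that meets the rate targets spends the unique optimal powers. -/
theorem isOptimalPower_iff [IsProbabilityMeasure nu] (H : IsFadingLaw nu)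
    (hK : 0 < K) (hmu : ∀ k, 0 < mu k)
    (hlam : ∀ k, 0 < lam k) {p : Fin K → ℝ} :
    IsOptimalPower nu mu (soleRate nu mu lam) p ↔ p = solePower nu mu lam := by
  obtain ⟨tau, ht⟩ := exists_isGreedyRule hK mu
  have hmem : solePower nu mu lam ∈ powerRegion nu (soleRate nu mu lam) :=
    ⟨_, _, H.meetsRates_greedy hmu hlam ht, H.solePower_mem_supportedPowers hmu hlam ht⟩
  constructor
  · rintro ⟨⟨t, r, hr, hp⟩, hopt⟩
    exact ((H.duality hmu hlam hr hp).2 (hopt _ hmem)).1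
  · rintro rfl
    exact ⟨hmem, fun q ⟨t, r, hr, hq⟩ => (H.duality hmu hlam hr hq).1⟩

/-- The greedy policy of `lam` meets the targets of `lam'` at the same optimal cost. The equality
case makes its rates those of `lam'` wherever it transmits. Each user transmits at positive rate on
a non-null event, where the rate determines the multiplier. -/
lemma soleRate_injective [IsProbabilityMeasure nu] (H : IsFadingLaw nu)
    (hK : 0 < K) (hmu : ∀ k, 0 < mu k)
    (hlam : ∀ k, 0 < lam k) {lam' : Fin K → ℝ} (hlam' : ∀ k, 0 < lam' k)
    (hpos : ∀ k, 0 < soleRate nu mu lam k) (he : soleRate nu mu lam = soleRate nu mu lam') :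
    lam = lam' := by
  obtain ⟨tau, ht⟩ := exists_isGreedyRule hK mu
  have hopt := (H.isOptimalPower_iff hK hmu hlam).2 rfl
  rw [he, H.isOptimalPower_iff hK hmu hlam'] at hopt
  have hae := ((H.duality hmu hlam' (he ▸ H.meetsRates_greedy hmu hlam ht)
    (H.solePower_mem_supportedPowers hmu hlam ht)).2 (by rw [hopt])).2
  funext k
  by_contra hne
  refine (hpos k).ne' (integral_eq_zero_of_ae ?_)
  filter_upwards [hae, H.ae_good hmu hlam] with h hh hg
  rw [Pi.zero_apply, ← time_mul_eq hmu hlam hg (ht.tau_sum lam hlam h)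
    (ht.tau_support lam hlam h) k (fun h => h), mul_eq_zero]
  by_contra! h0
  exact hne (eq_of_waterfillRate_eq (hlam k) (hlam' k)
    ((waterfillRate_nonneg _ _ _).lt_of_ne' h0.2) (hh k h0.1))

theorem isRateMap [IsProbabilityMeasure nu] (H : IsFadingLaw nu)
    (hK : 0 < K) (hmu : ∀ k, 0 < mu k) :
    IsRateMap (soleRate nu mu) where
  continuousAt _ hl := H.continuousAt_soleRate hmu hl
  anti l l' hl hll k hk := H.soleRate_mono hmu (fun j => (hl j).trans_le (hll j)) hl hk.ge
    fun j _ => hll j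
  mono l hl k x y hx hxy := H.soleRate_mono hmu (update_pos hl k hx)
    (update_pos hl k (hx.trans_le hxy)) (by simpa using hxy) fun j hj => by simp [hj]
  strictMono l hl k x y hx hxy := H.soleRate_strictMono hmu (update_pos hl k hx)
    (update_pos hl k (hx.trans hxy)) (by simpa using hxy) fun j hj => by simp [hj]
  small k _ hε := H.exists_soleRate_lt hmu k hε
  large := H.exists_lt_sum_soleRate hmu
  injective _ _ hl hl' := H.soleRate_injective hK hmu hl hl'

end IsFadingLaw

end TDMA

/-! ### Transfer to arbitrary greedy rules -/

open TDMA in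
theorem theorem5 {K : ℕ} (hK : 0 < K)
    -- the joint law of the fading state has a density and lives on non-negative gains
    (nu : MeasureTheory.Measure (Fin K → ℝ)) [MeasureTheory.IsProbabilityMeasure nu]
    (hdens : nu ≪ MeasureTheory.volume)
    (hnonneg : ∀ᵐ h ∂nu, ∀ k, 0 ≤ h k)
    -- average rates are finite
    (hlog : ∀ k, MeasureTheory.Integrable (fun h : Fin K → ℝ => Real.log (1 + h k)) nu)
    (mu : Fin K → ℝ) (hmu : ∀ k, 0 < mu k)
    (R : Fin K → ℝ) (hR : ∀ k, 0 < R k) :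
    ∃ lamStar pStar : Fin K → ℝ,
      (∀ k, 0 < lamStar k) ∧
      -- `pStar` is the unique optimal power vector
      IsOptimalPower nu mu R pStar ∧
      (∀ p, IsOptimalPower nu mu R p → p = pStar) ∧
      -- whatever the time division among several best users
      ∀ tau : (Fin K → ℝ) → (Fin K → ℝ) → Fin K → ℝ, IsGreedyRule mu tau →
        -- `lamStar` is the unique positive multiplier that meets the rate targets
        (∀ lam : Fin K → ℝ, (∀ k, 0 < lam k) →
          (avgRate nu mu tau lam = R ↔ lam = lamStar)) ∧
        -- its greedy allocation spends the optimal powers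
        avgPower nu mu tau lamStar = pStar ∧
        -- every update of the algorithm exists and is unique
        (∀ lam : Fin K → ℝ, (∀ k, 0 < lam k) →
          ∀ k, ∃! x : ℝ, IsUpdate nu mu R tau lam k x) ∧
        -- convergence of the algorithm from every positive initial vector
        ∀ seq : ℕ → Fin K → ℝ, IsRun nu mu R tau seq →
          Filter.Tendsto seq Filter.atTop (nhds lamStar) ∧
          Filter.Tendsto (fun l => avgPower nu mu tau (seq l)) Filter.atTop (nhds pStar) ∧
          Filter.Tendsto (fun l => avgRate nu mu tau (seq l)) Filter.atTop (nhds R) := by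
  have H : IsFadingLaw nu := ⟨hdens, hnonneg, hlog⟩
  have HR := H.isRateMap hK hmu
  obtain ⟨a, ha, haR, huniq, hconv⟩ := HR.exists_solution hR
  have hopt : ∀ p, IsOptimalPower nu mu R p ↔ p = solePower nu mu a := fun p => by
    rw [← haR]
    exact H.isOptimalPower_iff hK hmu ha
  refine ⟨a, solePower nu mu a, ha, (hopt _).2 rfl, fun p => (hopt p).1, fun tau ht => ?_⟩
  have hrate : ∀ l : Fin K → ℝ, (∀ k, 0 < l k) → avgRate nu mu tau l = soleRate nu mu l :=
    fun l hl => avgRate_eq_soleRate hdens hnonneg hmu hl ht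
  have hpower : ∀ l : Fin K → ℝ, (∀ k, 0 < l k) → avgPower nu mu tau l = solePower nu mu l :=
    fun l hl => avgPower_eq_solePower hdens hnonneg hmu hl ht
  have hupd : ∀ l : Fin K → ℝ, (∀ k, 0 < l k) → ∀ k x, IsUpdate nu mu R tau l k x ↔
      0 < x ∧ soleRate nu mu (Function.update l k x) k = R k := fun l hl k x =>
    and_congr_right fun hx => by rw [hrate _ (update_pos hl k hx)]
  refine ⟨fun l hl => ?_, hpower a ha, fun l hl k => ?_, fun s hs => ?_⟩
  · rw [hrate l hl]
    exact ⟨huniq l hl, fun h => h ▸ haR⟩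
  · simp only [hupd l hl k]
    exact HR.existsUnique_update hR hl k
  · have hpos : ∀ n k, 0 < s n k := by
      intro n
      cases n with
      | zero => exact hs.1
      | succ n => exact fun k => (hs.2 n k).1
    have hsa := hconv s ⟨hpos, fun n k => ((hupd _ (hpos n) k _).1 (hs.2 n k)).2⟩
    refine ⟨hsa, ?_, ?_⟩
    · simp only [hpower _ (hpos _)]
      exact (H.continuousAt_solePower hmu ha).tendsto.comp hsa
    · simp only [hrate _ (hpos _)]
      rw [← haR]
      exact (HR.continuousAt a ha).tendsto.comp hsa
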